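/- Let $n\ge 1$, $\alpha\in\mathbb R$, and let $V\in L^\infty_{loc}(\mathbb R^n\setminus\{0\})$ be real-valued, positive on $\mathbb R^n\setminus\{0\}$ and homogeneous of order $\alpha$, that is, $V(tx)=t^\alpha V(x)$ for all $t>0$ and $x\neq 0$. Assume that $\alpha>-2$ if $n\le 2$, and that $\alpha\ge n-4$ if $n\ge 3$. Let $u\in L^\infty(\mathbb R^n)$ be a real-valued bounded weak solution to $-\Delta u=Vu$ on $\mathbb R^n$, that is, $Vu\in L^1_{loc}(\mathbb R^n)$ and $$-\int_{\mathbb R^n}u\,\Delta\varphi\,dx=\int_{\mathbb R^n}Vu\,\varphi\,dx\qquad\text{for all }\varphi\in C_c^\infty(\mathbb R^n).$$ If $u$ is not almost everywhere zero on $\mathbb R^n$, then $u$ changes sign near $\infty$: for every $R$, the sets $\{|x|>R,\ u(x)>0\}$ and $\{|x|>R,\ u(x)<0\}$ both have positive Lebesgue measure. (Equivalently, if for some $R$ one has $u\ge 0$ a.e. on $\{|x|>R\}$, or $u\le 0$ a.e. on $\{|x|>R\}$, then $u=0$ a.e. on $\mathbb R^n$.) -/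

import Mathlib

open MeasureTheory Laplacian
open scoped ContDiff ENNReal

/-- The function `f` belongs to `L^∞_loc(U)`: it is (a.e. strongly) measurable and essentially
bounded on every compact subset of `U`. -/
def MemLinftyLoc {n : ℕ} (f : EuclideanSpace ℝ (Fin n) → ℝ)
    (U : Set (EuclideanSpace ℝ (Fin n))) : Prop :=
  ∀ K : Set (EuclideanSpace ℝ (Fin n)), IsCompact K → K ⊆ U → MemLp f ∞ (volume.restrict K)

/-- The function `f` is homogeneous of order `α` on `ℝⁿ ∖ {0}`. -/
def IsHomogeneousOfOrder {n : ℕ} (α : ℝ) (f : EuclideanSpace ℝ (Fin n) → ℝ) : Prop :=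
  ∀ t : ℝ, 0 < t → ∀ x : EuclideanSpace ℝ (Fin n), x ≠ 0 → f (t • x) = t ^ α * f x

/-- The function `u` is a weak (distributional) solution of `-Δ u = V u` on `ℝⁿ`: both `u` and
`V u` are locally integrable on `ℝⁿ` (so that both sides are distributions), and the equation
holds when tested against every smooth compactly supported function. -/
structure IsWeakSolution {n : ℕ} (V u : EuclideanSpace ℝ (Fin n) → ℝ) : Prop where
  locallyIntegrable : LocallyIntegrable u volume
  locallyIntegrable_mul : LocallyIntegrable (fun x => V x * u x) volume
  integral_eq : ∀ φ : EuclideanSpace ℝ (Fin n) → ℝ, ContDiff ℝ ∞ φ → HasCompactSupport φ →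
    -∫ x, u x * (Δ φ) x = ∫ x, V x * u x * φ x

/-- The function `u`, considered up to null sets, changes sign near infinity: outside every ball
around the origin it is positive on a set of positive measure and negative on a set of positive
measure. In other words, `u` is neither a.e. nonnegative nor a.e. nonpositive outside any ball. -/
def ChangesSignNearInfinity {n : ℕ} (u : EuclideanSpace ℝ (Fin n) → ℝ) : Prop :=
  ∀ R : ℝ, (∃ᵐ x ∂(volume : Measure (EuclideanSpace ℝ (Fin n))), R < ‖x‖ ∧ 0 < u x) ∧
    (∃ᵐ x ∂(volume : Measure (EuclideanSpace ℝ (Fin n))), R < ‖x‖ ∧ u x < 0)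

/-! If `u` does not change sign near infinity, then `u` or `-u` is nonnegative outside some ball;
say `u`. Two arguments show that `u` vanishes.

Vanishing near infinity. There `-Δu = Vu ≥ 0`, so `u` is superharmonic. By the strong minimum
principle (`IsWeaklySuperharmonicOn.ae_eq_zero_or_mollify_pos`) it is zero or has positive
mollifications; in the second case comparison with powers of `‖x‖` gives `u ≥ c‖x‖^(-m)` with `m =
max(0, n - 2)` (`IsWeaklySuperharmonicOn.exists_lower_bound`). On the other hand, testing the
equation with truncations of the harmonic function `‖x‖^(2-n)` and using that `u` is bounded gives
`∫ V u ‖x‖^(2-n) < ∞` near infinity (`lintegral_mul_rpow_lt_top`). The two facts conflict: `V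
‖x‖^(2-n-m)` is positive and homogeneous of degree `α + 2 - n - m ≥ -n`, hence not integrable
(`lintegral_eq_top_of_homogeneous`). The inequality is `α ≥ m - 2`, which the assumptions on `α`
provide. For `n = 1` the exterior of a ball is disconnected, so the argument runs in an open cone
`H` with `H ∪ {0}` closed: a half-line if `n = 1`, the punctured space otherwise.

Vanishing everywhere. No unique continuation is needed. The dilation `u_t(x) = u(tx)` solves `-Δu_t
= t^(2+α) V u_t`. Both `u` and `u_t` have compact support, so Green's identity gives `(1 - t^(2+α))
∫ V u u_t = 0`. Since `α ≠ -2`, the integral is zero for `t > 1`, and `t → 1` yields `∫ V u² = 0`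
(`ae_eq_zero_of_ae_eq_zero_near_infinity`).

Elliptic regularity is replaced throughout by a radial mollifier whose derivative in the scale is a
positive multiple of the Laplacian of a nonnegative bump; this makes mollifications of superharmonic
functions monotone in the scale. -/

open Filter Topology Metric Set

/-! ### Laplacians along lines, of radial functions, at minima and under dilation. -/

section LaplacianCalculus

variable {E : Type*} [NormedAddCommGroup E] [InnerProductSpace ℝ E]

/-- The second derivative of `f` in the direction `v`, as a second derivative along a line. -/
lemma iteratedFDeriv_two_eq_deriv_deriv {f : E → ℝ} {x : E} (hf : ContDiffAt ℝ 2 f x) (v : E) :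
    iteratedFDeriv ℝ 2 f x ![v, v] = deriv (deriv fun t : ℝ => f (x + t • v)) 0 := by
  have hline : ∀ t : ℝ, HasDerivAt (fun t : ℝ => x + t • v) v t := fun t => by
    simpa using ((hasDerivAt_id t).smul_const v).const_add x
  have hcont : ContinuousAt (fun t : ℝ => x + t • v) 0 := (hline 0).continuousAt
  have h0 : x + (0 : ℝ) • v = x := by simp
  have h1 : deriv (fun t : ℝ => f (x + t • v)) =ᶠ[𝓝 0] fun t => fderiv ℝ f (x + t • v) v := by
    have : ∀ᶠ y in 𝓝 (x + (0 : ℝ) • v), ContDiffAt ℝ 2 f y := by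
      rw [h0]; exact hf.eventually (by simp)
    filter_upwards [hcont.eventually this] with t ht
    have hd : HasFDerivAt f (fderiv ℝ f (x + t • v)) (x + t • v) :=
      (ht.differentiableAt (by simp)).hasFDerivAt
    exact (hd.comp_hasDerivAt t (hline t)).deriv
  have h2 : HasFDerivAt (fderiv ℝ f) (fderiv ℝ (fderiv ℝ f) x) (x + (0 : ℝ) • v) := by
    rw [h0]
    exact ((hf.fderiv_right (m := 1) (by norm_num)).differentiableAt (by simp)).hasFDerivAt
  have h3 : HasDerivAt (fun t : ℝ => fderiv ℝ f (x + t • v)) (fderiv ℝ (fderiv ℝ f) x v) 0 :=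
    h2.comp_hasDerivAt (0 : ℝ) (hline 0)
  have h4 : HasDerivAt (fun t : ℝ => fderiv ℝ f (x + t • v) v) (fderiv ℝ (fderiv ℝ f) x v v) 0 := by
    have := h3.clm_apply (hasDerivAt_const (0 : ℝ) v)
    rwa [map_zero, add_zero] at this
  rw [h1.deriv_eq, iteratedFDeriv_two_apply, h4.deriv]
  rfl

variable [FiniteDimensional ℝ E]

/-- The Laplacian of a radial function, written in terms of the squared distance to the centre. -/
lemma laplacian_comp_norm_sub_sq {p : ℝ → ℝ} {a x : E} (hp : ContDiffAt ℝ 2 p (‖x - a‖ ^ 2)) :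
    (Δ fun y : E => p (‖y - a‖ ^ 2)) x =
      4 * ‖x - a‖ ^ 2 * deriv (deriv p) (‖x - a‖ ^ 2)
        + 2 * Module.finrank ℝ E * deriv p (‖x - a‖ ^ 2) := by
  have hf : ContDiffAt ℝ 2 (fun y : E => p (‖y - a‖ ^ 2)) x :=
    ContDiffAt.comp x hp ((contDiffAt_id.sub contDiffAt_const).norm_sq ℝ)
  set s := ‖x - a‖ ^ 2 with hs
  -- On a line with unit direction `v` the function is `p(s + 2tb + t²)`; summing its second
  -- derivatives over an orthonormal basis uses Parseval for the `b²` terms.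
  have key : ∀ v : E, ‖v‖ = 1 →
      iteratedFDeriv ℝ 2 (fun y : E => p (‖y - a‖ ^ 2)) x ![v, v] =
        4 * inner ℝ v (x - a) ^ 2 * deriv (deriv p) s + 2 * deriv p s := by
    intro v hv
    rw [iteratedFDeriv_two_eq_deriv_deriv hf]
    set b : ℝ := inner ℝ v (x - a) with hb
    have e : (fun t : ℝ => p (‖x + t • v - a‖ ^ 2)) = fun t => p (s + 2 * t * b + t ^ 2) := by
      ext t
      have : x + t • v - a = (x - a) + t • v := by abel
      rw [this, norm_add_sq_real, norm_smul, hv, real_inner_smul_right, real_inner_comm, ← hb,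
        mul_one, Real.norm_eq_abs, sq_abs]
      congr 1; ring
    rw [e]
    have hpoly : ∀ t : ℝ, HasDerivAt (fun t : ℝ => s + 2 * t * b + t ^ 2) (2 * b + 2 * t) t := by
      intro t
      have h := ((((hasDerivAt_id' t).const_mul 2).mul_const b).const_add s).fun_add
        ((hasDerivAt_id' t).fun_pow 2)
      simpa using h
    have hcont : ContinuousAt (fun t : ℝ => s + 2 * t * b + t ^ 2) 0 := (hpoly 0).continuousAt
    have h1 : deriv (fun t : ℝ => p (s + 2 * t * b + t ^ 2)) =ᶠ[𝓝 0]
        fun t => deriv p (s + 2 * t * b + t ^ 2) * (2 * b + 2 * t) := by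
      have : ∀ᶠ y in 𝓝 (s + 2 * (0 : ℝ) * b + 0 ^ 2), ContDiffAt ℝ 2 p y := by
        simpa using hp.eventually (by simp)
      filter_upwards [hcont.eventually this] with t ht
      exact ((ht.differentiableAt (by simp)).hasDerivAt.comp t (hpoly t)).deriv
    have h2 : HasDerivAt (deriv p) (deriv (deriv p) s) (s + 2 * (0 : ℝ) * b + 0 ^ 2) := by
      have : ContDiffAt ℝ 1 (deriv p) s := by
        have h := (hp.fderiv_right (m := 1) (by norm_num)).clm_apply
          (contDiffAt_const (c := (1 : ℝ)))
        simpa using h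
      simpa using (this.differentiableAt (by simp)).hasDerivAt
    have h3 : HasDerivAt (fun t : ℝ => 2 * b + 2 * t) 2 0 := by
      simpa using ((hasDerivAt_id (0 : ℝ)).const_mul 2).const_add (2 * b)
    have h4 : HasDerivAt (fun t : ℝ => deriv p (s + 2 * t * b + t ^ 2))
        (deriv (deriv p) s * (2 * b + 2 * 0)) 0 :=
      HasDerivAt.comp (h₂ := deriv p) (0 : ℝ) h2 (hpoly 0)
    rw [h1.deriv_eq, (h4.fun_mul h3).deriv]
    simp
    ring
  rw [InnerProductSpace.laplacian_eq_iteratedFDeriv_orthonormalBasis _ (stdOrthonormalBasis ℝ E)]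
  simp only
  rw [Finset.sum_congr rfl fun i _ => key _ ((stdOrthonormalBasis ℝ E).norm_eq_one i),
    Finset.sum_add_distrib, ← Finset.sum_mul, ← Finset.mul_sum,
    (stdOrthonormalBasis ℝ E).sum_sq_inner_right]
  simp
  ring

/-- At a local minimum the Laplacian of a twice differentiable function is nonnegative. -/
lemma IsLocalMin.laplacian_nonneg {f : E → ℝ} {x : E} (hmin : IsLocalMin f x)
    (hf : ContDiffAt ℝ 2 f x) : 0 ≤ (Δ f) x := by
  rw [InnerProductSpace.laplacian_eq_iteratedFDeriv_orthonormalBasis _ (stdOrthonormalBasis ℝ E)]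
  refine Finset.sum_nonneg fun i _ => ?_
  set v := stdOrthonormalBasis ℝ E i
  rw [iteratedFDeriv_two_eq_deriv_deriv hf]
  set g : ℝ → ℝ := fun t => f (x + t • v) with hg
  have h0 : x + (0 : ℝ) • v = x := by simp
  have hcont : ContinuousAt (fun t : ℝ => x + t • v) 0 := by fun_prop
  have hgc : ContinuousAt g 0 := by
    refine ContinuousAt.comp (g := f) ?_ hcont
    rw [h0]; exact hf.continuousAt
  have hgmin : IsLocalMin g 0 := by
    have : ∀ᶠ y in 𝓝 (x + (0 : ℝ) • v), f x ≤ f y := by rw [h0]; exact hmin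
    filter_upwards [hcont.eventually this] with t ht
    simpa [hg] using ht
  -- A negative second derivative would make the minimum also a local maximum, so `g` would be
  -- locally constant and its second derivative zero.
  by_contra! hneg
  have hmax := isLocalMax_of_deriv_deriv_neg hneg hgmin.deriv_eq_zero hgc
  have hconst : g =ᶠ[𝓝 0] fun _ => g 0 := by
    filter_upwards [hmax, hgmin] with t h1 h2 using le_antisymm h1 h2
  have : deriv (deriv g) 0 = 0 := by
    rw [hconst.deriv.deriv_eq]; simp
  exact hneg.ne this

/-- The Laplacian of a dilated function. -/
lemma laplacian_comp_smul {f : E → ℝ} (hf : ContDiff ℝ 2 f) (c : ℝ) (x : E) :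
    (Δ fun y => f (c • y)) x = c ^ 2 * (Δ f) (c • x) := by
  rw [InnerProductSpace.laplacian_eq_iteratedFDeriv_orthonormalBasis _ (stdOrthonormalBasis ℝ E),
    InnerProductSpace.laplacian_eq_iteratedFDeriv_orthonormalBasis _ (stdOrthonormalBasis ℝ E)]
  simp only
  rw [Finset.mul_sum]
  refine Finset.sum_congr rfl fun i _ => ?_
  rw [iteratedFDeriv_two_eq_deriv_deriv hf.contDiffAt,
    iteratedFDeriv_two_eq_deriv_deriv (f := fun y => f (c • y))
      (hf.comp (contDiff_const_smul c)).contDiffAt]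
  set v := stdOrthonormalBasis ℝ E i
  set g : ℝ → ℝ := fun t => f (c • x + t • v)
  have e : (fun t : ℝ => f (c • (x + t • v))) = fun t => g (c * t) := by
    ext t; simp [g, smul_smul]
  have e' : deriv (fun t => g (c * t)) = fun t => c * deriv g (c * t) := by
    ext t; rw [deriv_comp_mul_left]; rfl
  rw [e, e', deriv_const_mul_field, deriv_comp_mul_left]
  simp; ring

lemma continuous_laplacian {f : E → ℝ} (hf : ContDiff ℝ 2 f) : Continuous (Δ f) := by
  rw [InnerProductSpace.laplacian_eq_iteratedFDeriv_orthonormalBasis _ (stdOrthonormalBasis ℝ E)]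
  refine continuous_finsetSum _ fun i _ => ?_
  have := hf.continuous_iteratedFDeriv (m := 2) le_rfl
  fun_prop

lemma laplacian_eq_zero_of_eventuallyEq_zero {f : E → ℝ} {x : E}
    (h : f =ᶠ[𝓝 x] 0) : (Δ f) x = 0 := by
  rw [(InnerProductSpace.laplacian_congr_nhds h).eq_of_nhds]
  exact congrFun (InnerProductSpace.laplacian_const (c := (0 : ℝ))) x

end LaplacianCalculus

lemma ContDiff.two_of_infty {F G : Type*} [NormedAddCommGroup F] [NormedSpace ℝ F]
    [NormedAddCommGroup G] [NormedSpace ℝ G] {f : F → G} (hf : ContDiff ℝ ∞ f) :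
    ContDiff ℝ 2 f :=
  contDiff_infty.mp hf 2

lemma deriv_comp_div (f : ℝ → ℝ) (c : ℝ) :
    deriv (fun s => f (s / c)) = fun s => c⁻¹ * deriv f (s / c) := by
  ext s
  have : (fun s => f (s / c)) = fun s => f (c⁻¹ * s) := by
    ext s; rw [div_eq_inv_mul]
  rw [this, deriv_comp_mul_left, smul_eq_mul, div_eq_inv_mul]

/-! ### One-variable profiles of the bump and of the mollifier. -/

section Profile

/-- The profile of the compactly supported radial potential whose Laplacian generates the
change of scale of the mollifier. -/
noncomputable def potentialProfile (s : ℝ) : ℝ := expNegInvGlue (1 - s)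

/-- The profile of the radial mollifier. -/
noncomputable def mollifierProfile (s : ℝ) : ℝ := -2 * deriv potentialProfile s

lemma contDiff_potentialProfile : ContDiff ℝ ∞ potentialProfile :=
  (expNegInvGlue.contDiff (n := ⊤)).comp (contDiff_const.sub contDiff_id)

lemma contDiff_mollifierProfile : ContDiff ℝ ∞ mollifierProfile :=
  contDiff_const.mul (contDiff_infty_iff_deriv.mp contDiff_potentialProfile).2

lemma potentialProfile_nonneg (s : ℝ) : 0 ≤ potentialProfile s := expNegInvGlue.nonneg _

lemma potentialProfile_eq_zero {s : ℝ} (hs : 1 ≤ s) : potentialProfile s = 0 :=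
  expNegInvGlue.zero_of_nonpos (by linarith)

/-- Computing the derivative within `[s, ∞)` covers the endpoint `s = 1`, where `f` need not vanish
on a full neighbourhood. -/
lemma deriv_eq_zero_of_forall_ge {f : ℝ → ℝ} (hf : ContDiff ℝ ∞ f) (h : ∀ s, 1 ≤ s → f s = 0)
    {s : ℝ} (hs : 1 ≤ s) : deriv f s = 0 := by
  have h1 : HasDerivWithinAt f (deriv f s) (Ici s) s :=
    ((hf.differentiable (by simp)) s).hasDerivAt.hasDerivWithinAt
  have h2 : HasDerivWithinAt f 0 (Ici s) s :=
    (hasDerivWithinAt_const s (Ici s) (0 : ℝ)).congr (fun y hy => h y (hs.trans hy)) (h s hs)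
  exact (uniqueDiffOn_Ici s s self_mem_Ici).eq_deriv _ h1 h2

lemma mollifierProfile_eq_zero {s : ℝ} (hs : 1 ≤ s) : mollifierProfile s = 0 := by
  rw [mollifierProfile, deriv_eq_zero_of_forall_ge contDiff_potentialProfile
    (fun _ h => potentialProfile_eq_zero h) hs, mul_zero]

lemma mollifierProfile_pos {s : ℝ} (hs : s < 1) : 0 < mollifierProfile s := by
  have h1 : HasDerivAt (fun s : ℝ => Real.exp (-(1 - s)⁻¹))
      (Real.exp (-(1 - s)⁻¹) * (-(1 / (1 - s) ^ 2))) s := by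
    have h := ((hasDerivAt_id' s).const_sub 1).fun_inv (by linarith)
    have h' := h.fun_neg.exp
    convert! h' using 2
    ring
  have h2 : potentialProfile =ᶠ[𝓝 s] fun s => Real.exp (-(1 - s)⁻¹) := by
    filter_upwards [Iio_mem_nhds hs] with t ht
    simp only [mem_Iio] at ht
    simp [potentialProfile, expNegInvGlue, not_le.mpr (sub_pos.mpr ht)]
  rw [mollifierProfile, h2.deriv_eq, h1.deriv]
  have : 0 < 1 - s := by linarith
  have : 0 < Real.exp (-(1 - s)⁻¹) * (1 / (1 - s) ^ 2) := by positivity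
  linarith

lemma mollifierProfile_nonneg (s : ℝ) : 0 ≤ mollifierProfile s := by
  rcases lt_or_ge s 1 with h | h
  · exact (mollifierProfile_pos h).le
  · exact (mollifierProfile_eq_zero h).ge

lemma exists_bound_of_forall_ge {f : ℝ → ℝ} (hf : Continuous f) (h : ∀ s, 1 ≤ s → f s = 0) :
    ∃ M : ℝ, 0 < M ∧ ∀ s, 0 ≤ s → |f s| ≤ M := by
  obtain ⟨M, hM⟩ := (isCompact_Icc (a := (0 : ℝ)) (b := 1)).exists_bound_of_continuousOn
    hf.continuousOn
  refine ⟨max M 1, by positivity, fun s hs => ?_⟩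
  rcases le_total s 1 with h1 | h1
  · exact (hM s ⟨hs, h1⟩).trans (le_max_left _ _)
  · rw [h s h1]; simp

end Profile

/-! ### The radial kernel and its derivative in the scale. -/

section Mollifier

variable {E : Type*} [NormedAddCommGroup E] [InnerProductSpace ℝ E]

/-- A radial mollifying kernel at scale `r`; its integral does not depend on `r`. -/
noncomputable def mollifierKernel (r : ℝ) (x : E) : ℝ :=
  (r ^ Module.finrank ℝ E)⁻¹ * mollifierProfile (‖x‖ ^ 2 / r ^ 2)

lemma contDiff_mollifierKernel (r : ℝ) : ContDiff ℝ ∞ (mollifierKernel r : E → ℝ) :=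
  contDiff_const.mul (contDiff_mollifierProfile.comp ((contDiff_norm_sq ℝ).div_const _))

lemma mollifierKernel_nonneg {r : ℝ} (hr : 0 < r) (x : E) : 0 ≤ mollifierKernel r x :=
  mul_nonneg (by positivity) (mollifierProfile_nonneg _)

lemma mollifierKernel_neg (r : ℝ) (x : E) : mollifierKernel r (-x) = mollifierKernel r x := by
  simp [mollifierKernel]

lemma mollifierKernel_sub_comm (r : ℝ) (x y : E) :
    mollifierKernel r (x - y) = mollifierKernel r (y - x) := by
  rw [← mollifierKernel_neg, neg_sub]

lemma one_le_sq_div_sq {r a : ℝ} (hr : 0 < r) (hx : r ≤ a) : 1 ≤ a ^ 2 / r ^ 2 := by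
  rw [le_div_iff₀ (by positivity), one_mul]; gcongr

lemma mollifierKernel_eq_zero {r : ℝ} (hr : 0 < r) {x : E} (hx : r ≤ ‖x‖) :
    mollifierKernel r x = 0 := by
  rw [mollifierKernel, mollifierProfile_eq_zero (one_le_sq_div_sq hr hx), mul_zero]

lemma mollifierKernel_pos {r : ℝ} (hr : 0 < r) {x : E} (hx : ‖x‖ < r) :
    0 < mollifierKernel r x := by
  refine mul_pos (by positivity) (mollifierProfile_pos ?_)
  rw [div_lt_one (by positivity)]; gcongr

lemma support_mollifierKernel_subset {r : ℝ} (hr : 0 < r) :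
    Function.support (mollifierKernel r : E → ℝ) ⊆ ball 0 r := by
  intro x hx
  by_contra h
  exact hx (mollifierKernel_eq_zero hr (by simpa using h))

/-- The derivative of the mollifying kernel with respect to the scale. -/
lemma hasDerivAt_mollifierKernel {r : ℝ} (hr : 0 < r) (x : E) :
    HasDerivAt (fun r => mollifierKernel r x)
      (-(r ^ (Module.finrank ℝ E + 1))⁻¹ *
        (Module.finrank ℝ E * mollifierProfile (‖x‖ ^ 2 / r ^ 2)
          + 2 * (‖x‖ ^ 2 / r ^ 2) * deriv mollifierProfile (‖x‖ ^ 2 / r ^ 2))) r := by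
  set n := Module.finrank ℝ E
  have h1 : HasDerivAt (fun r : ℝ => (r ^ n)⁻¹) (-(n : ℝ) * (r ^ (n + 1))⁻¹) r := by
    have := hasDerivAt_zpow (-(n : ℤ)) r (Or.inl hr.ne')
    simp only [zpow_neg, zpow_natCast] at this
    convert! this using 1
    push_cast
    congr 1
    rw [show -(n : ℤ) - 1 = -((n + 1 : ℕ) : ℤ) by push_cast; ring, zpow_neg, zpow_natCast]
  have h2 : HasDerivAt (fun r : ℝ => ‖x‖ ^ 2 / r ^ 2) (-2 * ‖x‖ ^ 2 / r ^ 3) r := by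
    have := (((hasDerivAt_id' r).fun_pow 2).fun_inv (by positivity)).const_mul (‖x‖ ^ 2)
    simp only [← div_eq_mul_inv] at this
    convert! this using 1
    field_simp
    norm_num
    exact Or.inl (by ring)
  have h3 := ((contDiff_mollifierProfile.differentiable (by simp))
    (‖x‖ ^ 2 / r ^ 2)).hasDerivAt.comp r h2
  convert! h1.fun_mul h3 using 1
  simp only [Function.comp]
  field_simp
  ring

lemma contDiff_mollifierKernel_sub_left (r : ℝ) (x : E) :
    ContDiff ℝ ∞ fun y => mollifierKernel r (x - y) :=
  (contDiff_mollifierKernel r).comp (contDiff_const.sub contDiff_id)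

lemma tsupport_mollifierKernel_sub_left_subset {r : ℝ} (hr : 0 < r) (x : E) :
    tsupport (fun y => mollifierKernel r (x - y)) ⊆ closedBall x r := by
  refine closure_minimal (fun y hy => ?_) isClosed_closedBall
  have := support_mollifierKernel_subset hr (Function.mem_support.mpr hy)
  rw [mem_ball_zero_iff, ← dist_eq_norm, dist_comm] at this
  exact this.le

variable [FiniteDimensional ℝ E]

lemma hasCompactSupport_mollifierKernel {r : ℝ} (hr : 0 < r) :
    HasCompactSupport (mollifierKernel r : E → ℝ) :=
  HasCompactSupport.of_support_subset_isCompact (isCompact_closedBall 0 r)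
    ((support_mollifierKernel_subset hr).trans ball_subset_closedBall)

lemma hasCompactSupport_mollifierKernel_sub_left {r : ℝ} (hr : 0 < r) (x : E) :
    HasCompactSupport fun y => mollifierKernel r (x - y) :=
  HasCompactSupport.of_support_subset_isCompact (isCompact_closedBall x r)
    (subset_closure.trans (tsupport_mollifierKernel_sub_left_subset hr x))

/-- The compactly supported potential whose Laplacian is, up to a factor, the derivative of the
mollifying kernel with respect to the scale. -/
lemma laplacian_potential {r : ℝ} (hr : 0 < r) (a x : E) :
    (Δ fun y : E => potentialProfile (‖y - a‖ ^ 2 / r ^ 2)) x =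
      -(r ^ 2)⁻¹ * (Module.finrank ℝ E * mollifierProfile (‖x - a‖ ^ 2 / r ^ 2)
        + 2 * (‖x - a‖ ^ 2 / r ^ 2) * deriv mollifierProfile (‖x - a‖ ^ 2 / r ^ 2)) := by
  have h2 : ContDiff ℝ 2 fun s => potentialProfile (s / r ^ 2) :=
    (contDiff_potentialProfile.comp (contDiff_id.div_const _)).two_of_infty
  have d1 : deriv (fun s => potentialProfile (s / r ^ 2)) =
      fun s => -(2 * r ^ 2)⁻¹ * mollifierProfile (s / r ^ 2) := by
    rw [deriv_comp_div]
    ext s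
    simp only [mollifierProfile]
    field_simp
  have d2 : deriv (fun s => -(2 * r ^ 2)⁻¹ * mollifierProfile (s / r ^ 2)) =
      fun s => -(2 * r ^ 2)⁻¹ * ((r ^ 2)⁻¹ * deriv mollifierProfile (s / r ^ 2)) := by
    ext s
    rw [deriv_const_mul_field, deriv_comp_div]
  rw [laplacian_comp_norm_sub_sq (p := fun s => potentialProfile (s / r ^ 2)) h2.contDiffAt,
    d1, d2]
  field_simp
  ring

end Mollifier

/-! ### Derivatives of convolutions with test functions. -/

section Convolution

variable {E : Type*} [NormedAddCommGroup E] [InnerProductSpace ℝ E] [FiniteDimensional ℝ E]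

/-- The Laplacian of a reflected and translated function. -/
lemma laplacian_comp_sub_left {f : E → ℝ} (hf : ContDiff ℝ 2 f) (a x : E) :
    (Δ fun y => f (a - y)) x = (Δ f) (a - x) := by
  rw [InnerProductSpace.laplacian_eq_iteratedFDeriv_orthonormalBasis _ (stdOrthonormalBasis ℝ E),
    InnerProductSpace.laplacian_eq_iteratedFDeriv_orthonormalBasis _ (stdOrthonormalBasis ℝ E)]
  refine Finset.sum_congr rfl fun i _ => ?_
  rw [iteratedFDeriv_two_eq_deriv_deriv hf.contDiffAt,
    iteratedFDeriv_two_eq_deriv_deriv (f := fun y => f (a - y))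
      (hf.comp (contDiff_const.sub contDiff_id)).contDiffAt]
  set v := stdOrthonormalBasis ℝ E i
  set g : ℝ → ℝ := fun t => f (a - x + t • v)
  have e : (fun t : ℝ => f (a - (x + t • v))) = fun t => g (-1 * t) := by
    ext t; simp only [g]; congr 1; module
  have e' : deriv (fun t => g (-1 * t)) = fun t => -1 * deriv g (-1 * t) := by
    ext t; rw [deriv_comp_mul_left]; rfl
  rw [e, e', deriv_const_mul_field, deriv_comp_mul_left]
  simp

variable [MeasurableSpace E] [BorelSpace E]

lemma fderiv_integral_mul_comp_sub {u g : E → ℝ} (hu : LocallyIntegrable u) (hg : ContDiff ℝ 1 g)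
    (hgc : HasCompactSupport g) (x v : E) :
    fderiv ℝ (fun x => ∫ y, u y * g (x - y)) x v = ∫ y, u y * fderiv ℝ g (x - y) v := by
  have h := hgc.hasFDerivAt_convolution_right (ContinuousLinearMap.mul ℝ ℝ) hu hg x
  have h1 := convolution_precompR_apply (ContinuousLinearMap.mul ℝ ℝ) hu (hgc.fderiv (𝕜 := ℝ))
    (hg.continuous_fderiv (by simp)) x v
  exact (congrArg (fun T : E →L[ℝ] ℝ => T v) h.fderiv).trans h1

lemma contDiff_integral_mul_comp_sub {u g : E → ℝ} (hu : LocallyIntegrable u)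
    (hg : ContDiff ℝ ∞ g) (hgc : HasCompactSupport g) :
    ContDiff ℝ ∞ fun x => ∫ y, u y * g (x - y) :=
  hgc.contDiff_convolution_right (n := ⊤) (ContinuousLinearMap.mul ℝ ℝ) hu hg

/-- The Laplacian of a convolution with a test function. -/
lemma laplacian_integral_mul_comp_sub {u g : E → ℝ} (hu : LocallyIntegrable u)
    (hg : ContDiff ℝ ∞ g) (hgc : HasCompactSupport g) (x : E) :
    (Δ fun x => ∫ y, u y * g (x - y)) x = ∫ y, u y * (Δ g) (x - y) := by
  have hconv := (contDiff_integral_mul_comp_sub hu hg hgc).two_of_infty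
  have hdd : ∀ (f : E → ℝ) (hf : ContDiff ℝ 2 f) (x v : E), iteratedFDeriv ℝ 2 f x ![v, v] =
      fderiv ℝ (fun x => fderiv ℝ f x v) x v := by
    intro f hf x v
    rw [iteratedFDeriv_two_apply]
    have h := ((hf.fderiv_right (m := 1) (by norm_num)).differentiable (by simp) x).hasFDerivAt
    have h2 := h.clm_apply (hasFDerivAt_const v x)
    rw [h2.fderiv]
    simp
  have hpart : ∀ v : E, ContDiff ℝ ∞ (fun x => fderiv ℝ g x v) := fun v =>
    (hg.fderiv_right (m := ∞) (by simp)).clm_apply contDiff_const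
  have hpartc : ∀ v : E, HasCompactSupport (fun x => fderiv ℝ g x v) := fun v =>
    hgc.fderiv_apply ℝ v
  rw [InnerProductSpace.laplacian_eq_iteratedFDeriv_orthonormalBasis _ (stdOrthonormalBasis ℝ E),
    InnerProductSpace.laplacian_eq_iteratedFDeriv_orthonormalBasis _ (stdOrthonormalBasis ℝ E)]
  simp only [Finset.mul_sum]
  rw [integral_finsetSum]
  · refine Finset.sum_congr rfl fun i _ => ?_
    set v := stdOrthonormalBasis ℝ E i
    rw [hdd _ hconv]
    have e : (fun x => fderiv ℝ (fun x => ∫ y, u y * g (x - y)) x v) =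
        fun x => ∫ y, u y * (fun z => fderiv ℝ g z v) (x - y) := by
      ext x
      exact fderiv_integral_mul_comp_sub hu (hg.of_le (by simp)) hgc x v
    rw [e, fderiv_integral_mul_comp_sub hu ((hpart v).of_le (by simp)) (hpartc v)]
    simp only [hdd g hg.two_of_infty]
  · intro i _
    set v := stdOrthonormalBasis ℝ E i
    simp only [hdd g hg.two_of_infty]
    have hc : HasCompactSupport (fun x => fderiv ℝ (fun x => fderiv ℝ g x v) x v) :=
      (hpartc v).fderiv_apply ℝ v
    have hcont : Continuous (fun x => fderiv ℝ (fun x => fderiv ℝ g x v) x v) :=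
      (((hpart v).fderiv_right (m := ∞) (by simp)).clm_apply contDiff_const).continuous
    exact (hc.convolutionExists_right (ContinuousLinearMap.mul ℝ ℝ) hu hcont x).integrable

lemma integrable_mul_comp_sub {u g : E → ℝ} (hu : LocallyIntegrable u) (hg : Continuous g)
    (hgc : HasCompactSupport g) (x : E) : Integrable fun y => u y * g (x - y) :=
  (hgc.convolutionExists_right (ContinuousLinearMap.mul ℝ ℝ) hu hg x).integrable

lemma integrable_mul_of_hasCompactSupport {u g : E → ℝ} (hu : LocallyIntegrable u)
    (hg : Continuous g) (hgc : HasCompactSupport g) : Integrable fun y => u y * g y := by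
  simpa [smul_eq_mul, mul_comm] using hu.integrable_smul_right_of_hasCompactSupport hg hgc

end Convolution

/-! ### Weak superharmonicity and monotone mollification. -/

section Superharmonic

variable {E : Type*} [NormedAddCommGroup E] [InnerProductSpace ℝ E] [FiniteDimensional ℝ E]
  [MeasurableSpace E] [BorelSpace E]

/-- The function `u` is superharmonic on `A` in the sense of distributions. -/
def IsWeaklySuperharmonicOn (u : E → ℝ) (A : Set E) : Prop :=
  ∀ φ : E → ℝ, ContDiff ℝ ∞ φ → HasCompactSupport φ → tsupport φ ⊆ A → (∀ x, 0 ≤ φ x) →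
    ∫ x, u x * (Δ φ) x ≤ 0

/-- The mollification of `u` at scale `r`. -/
noncomputable def mollify (u : E → ℝ) (r : ℝ) (x : E) : ℝ :=
  ∫ y, u y * mollifierKernel r (x - y)

variable {u : E → ℝ}

lemma contDiff_mollify (hu : LocallyIntegrable u) {r : ℝ} (hr : 0 < r) :
    ContDiff ℝ ∞ (mollify u r) :=
  contDiff_integral_mul_comp_sub hu (contDiff_mollifierKernel r)
    (hasCompactSupport_mollifierKernel hr)

lemma laplacian_mollify (hu : LocallyIntegrable u) {r : ℝ} (hr : 0 < r) (x : E) :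
    (Δ (mollify u r)) x = ∫ y, u y * (Δ fun y => mollifierKernel r (x - y)) y := by
  refine (laplacian_integral_mul_comp_sub hu (contDiff_mollifierKernel r)
    (hasCompactSupport_mollifierKernel hr) x).trans ?_
  simp only [laplacian_comp_sub_left (contDiff_mollifierKernel r).two_of_infty]

lemma IsWeaklySuperharmonicOn.laplacian_mollify_nonpos {A : Set E}
    (hA : IsWeaklySuperharmonicOn u A) (hu : LocallyIntegrable u) {r : ℝ} (hr : 0 < r) {x : E}
    (hx : closedBall x r ⊆ A) : (Δ (mollify u r)) x ≤ 0 := by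
  rw [laplacian_mollify hu hr]
  exact hA _ (contDiff_mollifierKernel_sub_left r x)
    (hasCompactSupport_mollifierKernel_sub_left hr x)
    ((tsupport_mollifierKernel_sub_left_subset hr x).trans hx)
    fun y => mollifierKernel_nonneg hr _

/-- Mollifications of weakly superharmonic functions increase as the scale decreases. -/
lemma IsWeaklySuperharmonicOn.mollify_anti {A : Set E} (hA : IsWeaklySuperharmonicOn u A)
    (hu : LocallyIntegrable u) {r₀ r₁ : ℝ} (hr₀ : 0 < r₀) (hr : r₀ ≤ r₁) {x : E}
    (hx : closedBall x r₁ ⊆ A) : mollify u r₁ x ≤ mollify u r₀ x := by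
  set n := Module.finrank ℝ E
  -- This is the bracket common to `hasDerivAt_mollifierKernel` and `laplacian_potential`.
  set G : ℝ → ℝ := fun s => n * mollifierProfile s + 2 * s * deriv mollifierProfile s with hG
  have hp' : ContDiff ℝ ∞ (deriv mollifierProfile) :=
    (contDiff_infty_iff_deriv.mp contDiff_mollifierProfile).2
  have hGc : Continuous G := by
    have := contDiff_mollifierProfile.continuous
    have := hp'.continuous
    fun_prop
  have hG1 : ∀ s, 1 ≤ s → G s = 0 := fun s hs => by
    simp only [hG]
    rw [mollifierProfile_eq_zero hs, deriv_eq_zero_of_forall_ge contDiff_mollifierProfile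
      (fun _ h => mollifierProfile_eq_zero h) hs]
    simp
  obtain ⟨M, hM, hGM⟩ := exists_bound_of_forall_ge hGc hG1
  have hder : ∀ r, 0 < r → HasDerivAt (fun r => mollify u r x)
      (∫ y, u y * (-(r ^ (n + 1))⁻¹ * G (‖x - y‖ ^ 2 / r ^ 2))) r := by
    intro r hr
    -- For scales in this interval all kernels are supported in one ball of radius `2 * r` and the
    -- factor `s ^ (-(n + 1))` is bounded, which gives a dominating function.
    have hball : Ioo (r / 2) (2 * r) ∈ 𝓝 r := Ioo_mem_nhds (by linarith) (by linarith)
    refine (hasDerivAt_integral_of_dominated_loc_of_deriv_le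
      (F := fun r y => u y * mollifierKernel r (x - y))
      (F' := fun r y => u y * (-(r ^ (n + 1))⁻¹ * G (‖x - y‖ ^ 2 / r ^ 2)))
      (bound := (closedBall x (2 * r)).indicator fun y => ‖u y‖ * (((r / 2) ^ (n + 1))⁻¹ * M))
      hball ?_ ?_ ?_ ?_ ?_ ?_).2
    · refine Eventually.of_forall fun s => ?_
      refine hu.aestronglyMeasurable.mul (Continuous.aestronglyMeasurable ?_)
      exact (contDiff_mollifierKernel_sub_left s x).continuous
    · exact integrable_mul_comp_sub hu (contDiff_mollifierKernel r).continuous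
        (hasCompactSupport_mollifierKernel hr) x
    · refine hu.aestronglyMeasurable.mul (Continuous.aestronglyMeasurable ?_)
      fun_prop
    · refine Eventually.of_forall fun y s hs => ?_
      have hs0 : 0 < s := by linarith [hs.1]
      by_cases hy : y ∈ closedBall x (2 * r)
      · rw [indicator_of_mem hy, norm_mul]
        gcongr
        rw [norm_mul, norm_neg, norm_inv, norm_pow, Real.norm_of_nonneg hs0.le]
        gcongr
        · exact hs.1.le
        · exact hGM _ (by positivity)
      · rw [indicator_of_notMem hy, hG1 _ (one_le_sq_div_sq hs0 ?_)]
        · simp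
        · rw [mem_closedBall, not_le, dist_comm, dist_eq_norm] at hy
          linarith [hs.2]
    · rw [integrable_indicator_iff isClosed_closedBall.measurableSet]
      exact ((hu.integrableOn_isCompact (isCompact_closedBall _ _)).norm).mul_const _
    · refine Eventually.of_forall fun y s hs => ?_
      have hs0 : 0 < s := by linarith [hs.1]
      exact (hasDerivAt_mollifierKernel hs0 (x - y)).const_mul (u y)
  have hneg : ∀ r, 0 < r → r ≤ r₁ →
      ∫ y, u y * (-(r ^ (n + 1))⁻¹ * G (‖x - y‖ ^ 2 / r ^ 2)) ≤ 0 := by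
    intro r hr hr1
    -- The scale derivative of the kernel is `r ^ (1 - n) * Δ ψ`, and `ψ ≥ 0` is an admissible test
    -- function, so superharmonicity fixes the sign.
    set ψ : E → ℝ := fun y => potentialProfile (‖y - x‖ ^ 2 / r ^ 2) with hψ
    have hsupp : tsupport ψ ⊆ closedBall x r := by
      refine closure_minimal (fun y hy => ?_) isClosed_closedBall
      by_contra h
      rw [mem_closedBall, not_le, dist_eq_norm] at h
      exact hy (potentialProfile_eq_zero (one_le_sq_div_sq hr h.le))
    have h := hA ψ (contDiff_potentialProfile.comp
        (((contDiff_id.sub contDiff_const).norm_sq ℝ).div_const _))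
      (HasCompactSupport.of_support_subset_isCompact (isCompact_closedBall x r)
        (subset_closure.trans hsupp))
      (hsupp.trans ((closedBall_subset_closedBall hr1).trans hx))
      fun y => potentialProfile_nonneg _
    have e : ∀ y, u y * (-(r ^ (n + 1))⁻¹ * G (‖x - y‖ ^ 2 / r ^ 2)) =
        (r ^ 2 * (r ^ (n + 1))⁻¹) * (u y * (Δ ψ) y) := by
      intro y
      rw [hψ, laplacian_potential hr, norm_sub_rev x y]
      rw [show Module.finrank ℝ E = n from rfl]
      simp only [hG]
      field_simp
    simp only [e, integral_const_mul]
    exact mul_nonpos_of_nonneg_of_nonpos (by positivity) h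
  have hanti : AntitoneOn (fun r => mollify u r x) (Icc r₀ r₁) := by
    refine antitoneOn_of_deriv_nonpos (convex_Icc _ _)
      (fun r hr => (hder r (hr₀.trans_le hr.1)).continuousAt.continuousWithinAt) ?_ ?_
    · intro r hr
      rw [interior_Icc] at hr
      exact (hder r (hr₀.trans hr.1)).differentiableAt.differentiableWithinAt
    · intro r hr
      rw [interior_Icc] at hr
      rw [(hder r (hr₀.trans hr.1)).deriv]
      exact hneg r (hr₀.trans hr.1) hr.2.le
  exact hanti (left_mem_Icc.mpr hr) (right_mem_Icc.mpr hr) hr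

/-- The common integral of the mollifying kernels. -/
noncomputable def mollifierMass (E : Type*) [NormedAddCommGroup E] [InnerProductSpace ℝ E]
    [FiniteDimensional ℝ E] [MeasurableSpace E] [BorelSpace E] : ℝ :=
  ∫ x : E, mollifierKernel 1 x

lemma integrable_mollifierKernel {r : ℝ} (hr : 0 < r) :
    Integrable (mollifierKernel r : E → ℝ) :=
  (contDiff_mollifierKernel r).continuous.integrable_of_hasCompactSupport
    (hasCompactSupport_mollifierKernel hr)

lemma integral_mollifierKernel {r : ℝ} (hr : 0 < r) :
    ∫ x : E, mollifierKernel r x = mollifierMass E := by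
  have h := Measure.integral_comp_inv_smul (volume : Measure E) (mollifierKernel 1) r
  have e : ∀ x : E, mollifierKernel 1 (r⁻¹ • x) = r ^ Module.finrank ℝ E * mollifierKernel r x := by
    intro x
    simp only [mollifierKernel, norm_smul, norm_inv, Real.norm_of_nonneg hr.le]
    have : (r⁻¹ * ‖x‖) ^ 2 / 1 ^ 2 = ‖x‖ ^ 2 / r ^ 2 := by field_simp
    rw [this]
    field_simp
    simp
  simp only [e, integral_const_mul, smul_eq_mul] at h
  rw [abs_of_pos (by positivity)] at h
  exact mul_left_cancel₀ (by positivity) h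

lemma mollifierMass_pos : 0 < mollifierMass E := by
  rw [mollifierMass, integral_pos_iff_support_of_nonneg (fun x => mollifierKernel_nonneg one_pos x)
    (integrable_mollifierKernel one_pos)]
  refine (isOpen_ball.measure_pos volume ⟨(0 : E), mem_ball_self one_pos⟩).trans_le
    (measure_mono fun x hx => (mollifierKernel_pos one_pos ?_).ne')
  simpa using hx

/-- Mollifications converge almost everywhere, up to the mass of the kernel. -/
lemma ae_tendsto_mollify (hu : LocallyIntegrable u) :
    ∀ᵐ x, Tendsto (fun r => (mollifierMass E)⁻¹ * mollify u r x) (𝓝[>] 0) (𝓝 (u x)) := by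
  obtain ⟨M, hM, hpM⟩ := exists_bound_of_forall_ge contDiff_mollifierProfile.continuous
    (fun _ h => mollifierProfile_eq_zero h)
  have hm := mollifierMass_pos (E := E)
  -- Lebesgue points suffice: the normalized kernel has integral one and is at most a constant over
  -- the volume of its supporting ball.
  filter_upwards [(Besicovitch.vitaliFamily volume).ae_tendsto_average_norm_sub hu] with x hx
  have h0 := hx.comp (Besicovitch.tendsto_filterAt volume x)
  have h1 := tendsto_integral_smul_of_tendsto_average_norm_sub (μ := volume)
    (g := fun r y => (mollifierMass E)⁻¹ * mollifierKernel r (x - y))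
    ((mollifierMass E)⁻¹ * M * volume.real (ball (0 : E) 1)) h0 ?_ ?_ ?_ ?_
  · refine h1.congr fun r => ?_
    rw [mollify, ← integral_const_mul]
    refine integral_congr_ae (Eventually.of_forall fun y => ?_)
    simp only [smul_eq_mul]; ring
  · filter_upwards with r using hu.integrableOn_isCompact (isCompact_closedBall _ _)
  · refine tendsto_const_nhds.congr' ?_
    filter_upwards [self_mem_nhdsWithin] with r hr
    rw [integral_const_mul, integral_sub_left_eq_self (mollifierKernel r) volume x,
      integral_mollifierKernel hr, inv_mul_cancel₀ hm.ne']
  · filter_upwards [self_mem_nhdsWithin] with r hr y hy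
    have : mollifierKernel r (x - y) ≠ 0 := fun h => hy (by simp [h])
    exact tsupport_mollifierKernel_sub_left_subset hr x (subset_closure this)
  · filter_upwards [self_mem_nhdsWithin] with r hr y
    rw [mem_Ioi] at hr
    rw [Measure.addHaar_real_closedBall _ _ hr.le, abs_mul, abs_of_pos (inv_pos.mpr hm),
      mollifierKernel, abs_mul, abs_of_pos (by positivity)]
    have hb : 0 < volume.real (ball (0 : E) 1) := by
      rw [measureReal_def]
      exact ENNReal.toReal_pos (isOpen_ball.measure_pos volume ⟨0, mem_ball_self one_pos⟩).ne'
        measure_ball_lt_top.ne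
    have := hpM (‖x - y‖ ^ 2 / r ^ 2) (by positivity)
    rw [mul_div_mul_right _ _ hb.ne', mul_div_assoc, div_eq_inv_mul M]
    gcongr

end Superharmonic

/-- `H` is open and closed in the punctured space, and a ball missing the origin is connected. -/
lemma closedBall_subset_of_isClosed_union_zero {E : Type*} [NormedAddCommGroup E]
    [NormedSpace ℝ E] {H : Set E} (hHo : IsOpen H) (hHc : IsClosed (H ∪ {0}))
    {x : E} (hx : x ∈ H) {r : ℝ} (hr : 0 ≤ r) (hrx : r < ‖x‖) : closedBall x r ⊆ H := by
  have hpre : IsPreconnected (closedBall x r) := (convex_closedBall x r).isPreconnected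
  refine hpre.subset_left_of_subset_union hHo hHc.isOpen_compl ?_ ?_
    ⟨x, mem_closedBall_self hr, hx⟩
  · exact disjoint_compl_right.mono_left subset_union_left
  · intro y hy
    by_cases h : y ∈ H ∪ {0}
    · rcases h with h | h
      · exact Or.inl h
      · rw [mem_singleton_iff.mp h, mem_closedBall, dist_comm, dist_zero_right] at hy
        linarith
    · exact Or.inr h

/-! ### Comparison with negative powers of the norm. -/

section Comparison

variable {E : Type*} [NormedAddCommGroup E] [InnerProductSpace ℝ E] [FiniteDimensional ℝ E] {H : Set E}

/-- Two exponents matter. For `b = -κ/2` the coefficient is `κ(κ + 2 - n)`, positive once `κ >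
max(0, n - 2)`; for `b = (2 - n)/2` it vanishes. -/
lemma laplacian_norm_sq_rpow (b : ℝ) {x : E} (hx : x ≠ 0) :
    (Δ fun y : E => (‖y‖ ^ 2) ^ b) x =
      4 * b * (b - 1 + Module.finrank ℝ E / 2) * (‖x‖ ^ 2) ^ (b - 1) := by
  have hs : 0 < ‖x‖ ^ 2 := by have := norm_pos_iff.mpr hx; positivity
  have h := laplacian_comp_norm_sub_sq (p := fun s : ℝ => s ^ b) (a := (0 : E)) (x := x)
    (by rw [sub_zero]; exact Real.contDiffAt_rpow_const_of_ne hs.ne')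
  simp only [sub_zero] at h
  rw [h, Real.deriv_rpow_const', deriv_const_mul_field, Real.deriv_rpow_const']
  have : (‖x‖ ^ 2) ^ (b - 1) = ‖x‖ ^ 2 * (‖x‖ ^ 2) ^ (b - 1 - 1) := by
    rw [Real.rpow_sub_one hs.ne' (b - 1)]
    field_simp
  beta_reduce
  rw [this]
  generalize (‖x‖ ^ 2) ^ (b - 1 - 1) = X
  ring

/-- Comparison of a nonnegative superharmonic function on a truncated cone with a negative power
of the distance to the origin. -/
lemma le_of_laplacian_nonpos {w : E → ℝ} (hw : ContDiff ℝ 2 w) (hHo : IsOpen H)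
    (hHc : IsClosed (H ∪ {0})) {R c m : ℝ} (hR : 0 < R) (hc : 0 < c)
    (hlap : ∀ x ∈ H, R < ‖x‖ → (Δ w) x ≤ 0) (hnn : ∀ x ∈ H, R ≤ ‖x‖ → 0 ≤ w x)
    (hbd : ∀ x ∈ H, ‖x‖ = R → c ≤ w x) (hm : 0 ≤ m) (hm' : (Module.finrank ℝ E : ℝ) - 2 ≤ m)
    {x : E} (hx : x ∈ H) (hxR : R ≤ ‖x‖) : c * (R / ‖x‖) ^ m ≤ w x := by
  have hpow : ∀ κ y : ℝ, 0 ≤ y → (y ^ 2) ^ (-(κ / 2)) = y ^ (-κ) := fun κ y hy => by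
    rw [← Real.rpow_natCast, ← Real.rpow_mul hy]
    congr 1
    push_cast
    ring
  -- Taking `κ > m` makes the barrier strictly subharmonic, and subtracting `ρ ^ (-κ)` makes it
  -- vanish on the outer sphere, so that nothing beyond `w ≥ 0` is needed there. Afterwards `ρ → ∞`
  -- and then `κ → m`.
  have key : ∀ κ, m < κ → ∀ ρ, ‖x‖ < ρ →
      c * R ^ κ * ((‖x‖ ^ 2) ^ (-(κ / 2)) - ρ ^ (-κ)) ≤ w x := by
    intro κ hκ ρ hρ
    have hκ0 : 0 < κ := hm.trans_lt hκ
    have hcR : 0 < c * R ^ κ := by positivity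
    -- Adjoining the origin makes the set closed; the condition `R ≤ ‖y‖` removes it again.
    set K : Set E := (closedBall 0 ρ ∩ {y | R ≤ ‖y‖}) ∩ (H ∪ {0}) with hK
    have hKc : IsCompact K :=
      ((isCompact_closedBall _ _).inter_right (isClosed_le continuous_const continuous_norm)
        ).inter_right hHc
    have hKH : ∀ y ∈ K, y ∈ H := by
      rintro y ⟨⟨-, hy⟩, hy' | hy'⟩
      · exact hy'
      · rw [mem_singleton_iff.mp hy', mem_ofPred_eq, norm_zero] at hy
        linarith
    set b : E → ℝ := fun y => (‖y‖ ^ 2) ^ (-(κ / 2)) with hb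
    have hbs : ∀ y : E, y ≠ 0 → ContDiffAt ℝ 2 b y := fun y hy =>
      ContDiffAt.comp y (g := fun s : ℝ => s ^ (-(κ / 2)))
        (Real.contDiffAt_rpow_const_of_ne (by simpa using hy)) (contDiff_norm_sq ℝ).contDiffAt
    set g : E → ℝ := w - (c * R ^ κ) • b with hg
    have hK0 : ∀ y ∈ K, y ≠ 0 := by
      rintro y ⟨⟨-, hy⟩, -⟩ rfl
      rw [mem_ofPred_eq, norm_zero] at hy
      linarith
    have hgs : ∀ y ∈ K, ContDiffAt ℝ 2 g y := fun y hy =>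
      hw.contDiffAt.sub (contDiffAt_const.smul (hbs y (hK0 y hy)))
    have hxK : x ∈ K := ⟨⟨by simpa using hρ.le, hxR⟩, Or.inl hx⟩
    obtain ⟨z, hz, hzmin⟩ := hKc.exists_isMinOn ⟨x, hxK⟩
      fun y hy => (hgs y hy).continuousAt.continuousWithinAt
    have hzR : R ≤ ‖z‖ := hz.1.2
    have hzρ : ‖z‖ ≤ ρ := by simpa using hz.1.1
    have hzH := hKH z hz
    have hgz : -(c * R ^ κ * ρ ^ (-κ)) ≤ g z := by
      have hgz' : g z = w z - c * R ^ κ * ‖z‖ ^ (-κ) := by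
        simp only [hg, hb, Pi.sub_apply, Pi.smul_apply, smul_eq_mul]
        rw [hpow κ _ (norm_nonneg z)]
      have hρ0 : 0 < ρ := hR.trans_le (hzR.trans hzρ)
      rcases hzR.eq_or_lt with h1 | h1
      · have hRR : c * R ^ κ * R ^ (-κ) = c := by
          rw [mul_assoc c, ← Real.rpow_add hR, add_neg_cancel, Real.rpow_zero, mul_one]
        rw [hgz', ← h1, hRR]
        have := hbd z hzH h1.symm
        have : 0 ≤ c * R ^ κ * ρ ^ (-κ) := by positivity
        linarith
      rcases hzρ.eq_or_lt with h2 | h2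
      · rw [hgz', h2]
        have := hnn z hzH hzR
        linarith
      -- The remaining case is an interior minimum of `g`, impossible because `Δ g < 0` there.
      exfalso
      have hKz : K ∈ 𝓝 z := by
        filter_upwards [hHo.mem_nhds hzH, (continuous_norm.tendsto z).eventually (lt_mem_nhds h1),
          (continuous_norm.tendsto z).eventually (gt_mem_nhds h2)] with y hy1 hy2 hy3
        exact ⟨⟨by simpa using hy3.le, le_of_lt hy2⟩, Or.inl hy1⟩
      have hmin := (hzmin.isLocalMin hKz).laplacian_nonneg (hgs z hz)
      have hbz : ContDiffAt ℝ 2 ((c * R ^ κ) • b) z := contDiffAt_const.smul (hbs z (hK0 z hz))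
      rw [hg, ContDiffAt.laplacian_sub hw.contDiffAt hbz,
        InnerProductSpace.laplacian_smul _ (hbs z (hK0 z hz)), hb,
        laplacian_norm_sq_rpow _ (hK0 z hz), smul_eq_mul] at hmin
      have hz0 : 0 < ‖z‖ := hR.trans h1
      have h3 := hlap z hzH h1
      have h4 : 0 < c * R ^ κ * (4 * -(κ / 2) * (-(κ / 2) - 1 + Module.finrank ℝ E / 2) *
          (‖z‖ ^ 2) ^ (-(κ / 2) - 1)) := by
        refine mul_pos hcR (mul_pos ?_ (by positivity))
        nlinarith
      linarith
    have := hgz.trans (hzmin hxK)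
    simp only [hg, hb, Pi.sub_apply, Pi.smul_apply, smul_eq_mul] at this
    linarith
  have hx0 : 0 < ‖x‖ := hR.trans_le hxR
  have key2 : ∀ κ, m < κ → c * (R / ‖x‖) ^ κ ≤ w x := by
    intro κ hκ
    have hκ0 : 0 < κ := hm.trans_lt hκ
    have hlim : Tendsto (fun ρ : ℝ => c * R ^ κ * ((‖x‖ ^ 2) ^ (-(κ / 2)) - ρ ^ (-κ))) atTop
        (𝓝 (c * R ^ κ * ((‖x‖ ^ 2) ^ (-(κ / 2)) - 0))) :=
      ((tendsto_rpow_neg_atTop hκ0).const_sub _).const_mul _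
    have h := le_of_tendsto hlim ((eventually_gt_atTop ‖x‖).mono fun ρ hρ => key κ hκ ρ hρ)
    rw [sub_zero, hpow κ _ (norm_nonneg x)] at h
    rwa [Real.div_rpow hR.le hx0.le, div_eq_mul_inv, ← Real.rpow_neg hx0.le, ← mul_assoc]
  have hlim : Tendsto (fun κ : ℝ => c * (R / ‖x‖) ^ κ) (𝓝[>] m) (𝓝 (c * (R / ‖x‖) ^ m)) := by
    refine Tendsto.mono_left ?_ nhdsWithin_le_nhds
    exact ((Real.continuous_const_rpow (by positivity)).tendsto m).const_mul c
  exact le_of_tendsto hlim (eventually_mem_nhdsWithin.mono fun κ hκ => key2 κ hκ)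

end Comparison

/-! ### Strong minimum principle and the lower bound at infinity. -/

section MinimumPrinciple

variable {E : Type*} [NormedAddCommGroup E] [InnerProductSpace ℝ E] [FiniteDimensional ℝ E]
  [MeasurableSpace E] [BorelSpace E] {u : E → ℝ} {A H : Set E}

lemma mollify_nonneg {r : ℝ} (hr : 0 < r) {x : E} (h : ∀ᵐ y, y ∈ ball x r → 0 ≤ u y) :
    0 ≤ mollify u r x := by
  refine integral_nonneg_of_ae ?_
  filter_upwards [h] with y hy
  by_cases hyr : y ∈ ball x r
  · exact mul_nonneg (hy hyr) (mollifierKernel_nonneg hr _)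
  · rw [mem_ball, not_lt, dist_comm, dist_eq_norm] at hyr
    simp [mollifierKernel_eq_zero hr hyr]

lemma ae_eq_zero_of_mollify_eq_zero (hu : LocallyIntegrable u) {r : ℝ} (hr : 0 < r) {x : E}
    (h : ∀ᵐ y, y ∈ ball x r → 0 ≤ u y) (h0 : mollify u r x = 0) :
    ∀ᵐ y, y ∈ ball x r → u y = 0 := by
  have hnn : 0 ≤ᵐ[volume] fun y => u y * mollifierKernel r (x - y) := by
    filter_upwards [h] with y hy
    by_cases hyr : y ∈ ball x r
    · exact mul_nonneg (hy hyr) (mollifierKernel_nonneg hr _)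
    · rw [mem_ball, not_lt, dist_comm, dist_eq_norm] at hyr
      simp [mollifierKernel_eq_zero hr hyr]
  rw [mollify, integral_eq_zero_iff_of_nonneg_ae hnn (integrable_mul_comp_sub hu
    (contDiff_mollifierKernel r).continuous (hasCompactSupport_mollifierKernel hr) x)] at h0
  filter_upwards [h0] with y hy hyr
  rw [mem_ball, dist_comm, dist_eq_norm] at hyr
  exact (mul_eq_zero.mp hy).resolve_right (mollifierKernel_pos hr hyr).ne'

lemma mollify_eq_zero {r : ℝ} (hr : 0 < r) {x : E} (h : ∀ᵐ y, y ∈ ball x r → u y = 0) :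
    mollify u r x = 0 := by
  refine integral_eq_zero_of_ae ?_
  filter_upwards [h] with y hy
  by_cases hyr : y ∈ ball x r
  · simp [hy hyr]
  · rw [mem_ball, not_lt, dist_comm, dist_eq_norm] at hyr
    simp [mollifierKernel_eq_zero hr hyr]

/-- The strong minimum principle for weakly superharmonic functions. -/
lemma IsWeaklySuperharmonicOn.ae_eq_zero_or_mollify_pos (hA : IsWeaklySuperharmonicOn u A)
    (hu : LocallyIntegrable u) (hAo : IsOpen A) (hAc : IsPreconnected A)
    (hnn : ∀ᵐ x, x ∈ A → 0 ≤ u x) :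
    (∀ᵐ x, x ∈ A → u x = 0) ∨ ∀ x r, 0 < r → closedBall x r ⊆ A → 0 < mollify u r x := by
  have hnn' : ∀ {x r}, closedBall x r ⊆ A → ∀ᵐ y, y ∈ ball x r → 0 ≤ u y := by
    intro x r hx
    filter_upwards [hnn] with y hy hyr using hy (hx (ball_subset_closedBall hyr))
  -- Connectedness argument: the set of points near which `u` vanishes is open, and so is its
  -- complement in `A`.
  set Z : Set E := {x | x ∈ A ∧ ∃ r > 0, ∀ᵐ y, y ∈ ball x r → u y = 0} with hZ
  have hZo : IsOpen Z := by
    rw [Metric.isOpen_iff]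
    rintro x ⟨hxA, r, hr, hx⟩
    obtain ⟨ε, hε, hεA⟩ := Metric.isOpen_iff.mp hAo x hxA
    refine ⟨min ε (r / 2), by positivity, fun z hz => ⟨hεA (ball_subset_ball (min_le_left _ _) hz),
      r / 2, by positivity, ?_⟩⟩
    have hz' : dist z x < r / 2 := lt_of_lt_of_le hz (min_le_right _ _)
    filter_upwards [hx] with y hy hyz
    refine hy ?_
    rw [mem_ball] at hyz ⊢
    linarith [dist_triangle y z x]
  have hWo : IsOpen (A \ Z) := by
    rw [Metric.isOpen_iff]
    rintro x ⟨hxA, hxZ⟩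
    obtain ⟨ε, hε, hεA⟩ := Metric.isOpen_iff.mp hAo x hxA
    refine ⟨ε / 4, by positivity, fun z hz => ⟨hεA (ball_subset_ball (by linarith) hz), ?_⟩⟩
    rintro ⟨-, r, hr, hzr⟩
    rw [mem_ball] at hz
    have hball : closedBall z (ε / 2) ⊆ A := fun y hy => hεA <| by
      rw [mem_closedBall] at hy
      rw [mem_ball]
      linarith [dist_triangle y z x]
    have h0 : mollify u (min r (ε / 2)) z = 0 := mollify_eq_zero (by positivity) <| by
      filter_upwards [hzr] with y hy hyz using hy (ball_subset_ball (min_le_left _ _) hyz)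
    -- Vanishing at a small scale around `z` propagates to the fixed scale `ε / 2` by monotonicity.
    -- That ball contains `ball x (ε / 4)`, so `x` would lie in `Z`.
    have h1 := hA.mollify_anti hu (by positivity) (min_le_right r (ε / 2)) hball
    have h2 := mollify_nonneg (u := u) (by positivity : 0 < ε / 2) (hnn' hball)
    have h3 := ae_eq_zero_of_mollify_eq_zero hu (by positivity) (hnn' hball)
      (le_antisymm (h1.trans h0.le) h2)
    refine hxZ ⟨hxA, ε / 4, by positivity, ?_⟩
    filter_upwards [h3] with y hy hyx
    refine hy ?_
    rw [mem_ball] at hyx ⊢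
    linarith [dist_triangle y x z, dist_comm x z]
  by_cases hne : (A ∩ Z).Nonempty
  · left
    have hAZ : A ⊆ Z := hAc.subset_left_of_subset_union hZo hWo disjoint_sdiff_right
      (fun x hx => by by_cases h : x ∈ Z <;> simp [h, hx]) hne
    have : volume ({x | u x ≠ 0} ∩ A) = 0 := by
      refine measure_null_of_locally_null _ fun x hx => ?_
      obtain ⟨-, r, hr, hxr⟩ := hAZ hx.2
      refine ⟨ball x r ∩ ({x | u x ≠ 0} ∩ A),
        inter_mem (mem_nhdsWithin_of_mem_nhds (ball_mem_nhds x hr)) self_mem_nhdsWithin, ?_⟩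
      refine measure_mono_null ?_ hxr
      rintro y ⟨hy1, hy2, -⟩ h
      exact hy2 (h hy1)
    filter_upwards [measure_eq_zero_iff_ae_notMem.mp this] with x hx hxA
    by_contra h
    exact hx ⟨h, hxA⟩
  · right
    intro x r hr hx
    refine lt_of_le_of_ne (mollify_nonneg hr (hnn' hx)) fun h => hne ?_
    have hxA := hx (mem_closedBall_self hr.le)
    exact ⟨x, hxA, hxA, r, hr, ae_eq_zero_of_mollify_eq_zero hu hr (hnn' hx) h.symm⟩

/-- A nonnegative superharmonic function near infinity in a cone decays no faster than the
fundamental solution. -/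
lemma IsWeaklySuperharmonicOn.exists_lower_bound {R m : ℝ} (hR : 0 < R)
    (hA : IsWeaklySuperharmonicOn u (H ∩ {x | R < ‖x‖})) (hu : LocallyIntegrable u)
    (hHo : IsOpen H) (hHc : IsClosed (H ∪ {0}))
    (hpos : ∀ x r, 0 < r → closedBall x r ⊆ H ∩ {x | R < ‖x‖} → 0 < mollify u r x)
    (hm : 0 ≤ m) (hm' : (Module.finrank ℝ E : ℝ) - 2 ≤ m) :
    ∃ c > 0, ∀ᵐ x, x ∈ H → R + 2 ≤ ‖x‖ → c * ‖x‖ ^ (-m) ≤ u x := by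
  have hball : ∀ x ∈ H, R + 2 ≤ ‖x‖ → closedBall x 1 ⊆ H ∩ {x | R < ‖x‖} := by
    intro x hx hxR y hy
    refine ⟨closedBall_subset_of_isClosed_union_zero hHo hHc hx zero_le_one (by linarith) hy, ?_⟩
    rw [mem_closedBall, dist_eq_norm] at hy
    have := norm_sub_norm_le x y
    rw [norm_sub_rev] at this
    show R < ‖y‖
    linarith
  -- The constant is taken at scale one. Monotonicity gives the same constant for every scale `s ≤
  -- 1`, so the comparison survives the limit `s → 0`.
  obtain ⟨c, hc, hcmin⟩ : ∃ c > 0, ∀ x ∈ H, ‖x‖ = R + 2 → c ≤ mollify u 1 x := by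
    set K : Set E := sphere 0 (R + 2) ∩ (H ∪ {0}) with hK
    have hKc : IsCompact K := (isCompact_sphere _ _).inter_right hHc
    have hcont : Continuous (mollify u 1) := (contDiff_mollify hu one_pos).continuous
    rcases K.eq_empty_or_nonempty with h | h
    · refine ⟨1, one_pos, fun x hx hxR => ?_⟩
      have : x ∈ K := ⟨by simpa using hxR, Or.inl hx⟩
      rw [h] at this
      exact this.elim
    · obtain ⟨z, hz, hzmin⟩ := hKc.exists_isMinOn h hcont.continuousOn
      have hzn : ‖z‖ = R + 2 := by simpa using hz.1
      have hzH : z ∈ H := by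
        rcases hz.2 with h | h
        · exact h
        · rw [mem_singleton_iff.mp h, norm_zero] at hzn
          linarith
      exact ⟨mollify u 1 z, hpos z 1 one_pos (hball z hzH hzn.ge),
        fun x hx hxR => hzmin ⟨by simpa using hxR, Or.inl hx⟩⟩
  have hmass := mollifierMass_pos (E := E)
  refine ⟨(mollifierMass E)⁻¹ * (c * (R + 2) ^ m), by positivity, ?_⟩
  filter_upwards [ae_tendsto_mollify hu] with x hx hxH hxR
  refine ge_of_tendsto hx ?_
  filter_upwards [Ioc_mem_nhdsGT one_pos] with s hs
  have hanti : ∀ y ∈ H, R + 2 ≤ ‖y‖ → mollify u 1 y ≤ mollify u s y := fun y hy hyR =>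
    hA.mollify_anti hu hs.1 hs.2 (hball y hy hyR)
  have h := le_of_laplacian_nonpos (contDiff_mollify hu hs.1).two_of_infty hHo hHc
    (by linarith : 0 < R + 2) hc
    (fun y hy hyR => hA.laplacian_mollify_nonpos hu hs.1
      ((closedBall_subset_closedBall hs.2).trans (hball y hy hyR.le)))
    (fun y hy hyR => (hpos y 1 one_pos (hball y hy hyR)).le.trans (hanti y hy hyR))
    (fun y hy hyR => (hcmin y hy hyR).trans (hanti y hy hyR.ge)) hm hm' hxH hxR
  rw [mul_assoc]
  gcongr
  rwa [Real.div_rpow (by linarith) (norm_nonneg x), div_eq_mul_inv,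
    ← Real.rpow_neg (norm_nonneg x), ← mul_assoc] at h

end MinimumPrinciple

/-! ### Integrability against the function `‖x‖ ^ (2 - n)`. -/

section TruncatedFundamentalSolution

variable {E : Type*} [NormedAddCommGroup E] [InnerProductSpace ℝ E]

/-- The function `‖x‖ ^ (2 - n)`, which is harmonic away from the origin, cut off smoothly at
scale `ρ`. -/
noncomputable def truncatedFundamental (ρ : ℝ) (x : E) : ℝ :=
  Real.smoothTransition (‖x‖ ^ 2 / ρ ^ 2 - 1) * (‖x‖ ^ 2) ^ ((2 - Module.finrank ℝ E : ℝ) / 2)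

lemma contDiff_truncatedFundamental {ρ : ℝ} (hρ : 0 < ρ) :
    ContDiff ℝ ∞ (truncatedFundamental ρ : E → ℝ) := by
  set b : ℝ := (2 - Module.finrank ℝ E : ℝ) / 2 with hb
  have h : ContDiff ℝ ∞ fun s : ℝ => Real.smoothTransition (s / ρ ^ 2 - 1) * s ^ b := by
    rw [contDiff_iff_contDiffAt]
    intro s
    rcases lt_or_ge 0 s with hs | hs
    · refine ContDiffAt.mul ?_ (Real.contDiffAt_rpow_const_of_ne hs.ne')
      exact ((Real.smoothTransition.contDiff (n := ⊤)).comp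
        ((contDiff_id.div_const _).sub contDiff_const)).contDiffAt
    · refine (contDiffAt_const (c := (0 : ℝ))).congr_of_eventuallyEq ?_
      filter_upwards [Iio_mem_nhds (show s < ρ ^ 2 by linarith [sq_pos_of_pos hρ])] with t ht
      rw [Real.smoothTransition.zero_of_nonpos, zero_mul]
      rw [sub_nonpos, div_le_one (by positivity)]
      exact le_of_lt ht
  exact h.comp (contDiff_norm_sq ℝ)

lemma truncatedFundamental_eq_zero {ρ : ℝ} (hρ : 0 < ρ) {x : E} (hx : ‖x‖ ≤ ρ) :
    truncatedFundamental ρ x = 0 := by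
  rw [truncatedFundamental, Real.smoothTransition.zero_of_nonpos, zero_mul]
  rw [sub_nonpos, div_le_one (by positivity)]
  gcongr

lemma truncatedFundamental_eq_rpow {ρ : ℝ} (hρ : 0 < ρ) {x : E} (hx : 2 * ρ ≤ ‖x‖) :
    truncatedFundamental ρ x = (‖x‖ ^ 2) ^ ((2 - Module.finrank ℝ E : ℝ) / 2) := by
  rw [truncatedFundamental, Real.smoothTransition.one_of_one_le, one_mul]
  rw [le_sub_iff_add_le, le_div_iff₀ (by positivity)]
  nlinarith

lemma truncatedFundamental_anti {ρ₁ ρ₂ : ℝ} (hρ : 0 < ρ₁) (h : ρ₁ ≤ ρ₂) (x : E) :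
    truncatedFundamental ρ₂ x ≤ truncatedFundamental ρ₁ x := by
  refine mul_le_mul_of_nonneg_right (Real.smoothTransition.monotone ?_) (by positivity)
  gcongr

variable [FiniteDimensional ℝ E]

lemma laplacian_truncatedFundamental_eq_zero {ρ : ℝ} (hρ : 0 < ρ) {x : E} (hx : 2 * ρ < ‖x‖) :
    (Δ (truncatedFundamental ρ : E → ℝ)) x = 0 := by
  have h : truncatedFundamental ρ =ᶠ[𝓝 x]
      fun y : E => (‖y‖ ^ 2) ^ ((2 - Module.finrank ℝ E : ℝ) / 2) := by
    filter_upwards [(continuous_norm.tendsto x).eventually (lt_mem_nhds hx)] with y hy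
    exact truncatedFundamental_eq_rpow hρ hy.le
  have hx0 : x ≠ 0 := norm_pos_iff.mp (by linarith)
  rw [(InnerProductSpace.laplacian_congr_nhds h).eq_of_nhds, laplacian_norm_sq_rpow _ hx0]
  ring

lemma hasCompactSupport_laplacian_truncatedFundamental {ρ : ℝ} (hρ : 0 < ρ) :
    HasCompactSupport (Δ (truncatedFundamental ρ : E → ℝ)) := by
  refine HasCompactSupport.of_support_subset_isCompact (isCompact_closedBall 0 (2 * ρ)) ?_
  intro x hx
  by_contra h
  exact hx (laplacian_truncatedFundamental_eq_zero hρ (by simpa using h))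

/-- The truncations are dilates of one another up to the factor `ρ ^ (2 - n)`. The resulting scaling
of the Laplacian preserves its `L¹` norm, which makes the bounds below uniform in `ρ`. -/
lemma laplacian_truncatedFundamental {ρ : ℝ} (hρ : 0 < ρ) (x : E) :
    (Δ (truncatedFundamental ρ : E → ℝ)) x =
      (ρ ^ Module.finrank ℝ E)⁻¹ * (Δ (truncatedFundamental 1 : E → ℝ)) (ρ⁻¹ • x) := by
  have e : (truncatedFundamental ρ : E → ℝ) =
      (ρ ^ (2 - Module.finrank ℝ E : ℝ)) • fun y : E => truncatedFundamental 1 (ρ⁻¹ • y) := by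
    ext y
    simp only [truncatedFundamental, Pi.smul_apply, smul_eq_mul, norm_smul, norm_inv,
      Real.norm_of_nonneg hρ.le, mul_pow, one_pow, div_one, inv_pow]
    rw [Real.mul_rpow (by positivity) (by positivity), Real.inv_rpow (by positivity),
      ← Real.rpow_natCast ρ 2, ← Real.rpow_mul hρ.le]
    have : (ρ ^ (((2 : ℕ) : ℝ) * ((2 - Module.finrank ℝ E : ℝ) / 2))) =
        ρ ^ (2 - Module.finrank ℝ E : ℝ) := by
      congr 1; push_cast; ring
    rw [this]
    have : 0 < ρ ^ (2 - Module.finrank ℝ E : ℝ) := by positivity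
    field_simp
  have hT : ContDiff ℝ 2 (truncatedFundamental 1 : E → ℝ) :=
    (contDiff_truncatedFundamental one_pos).two_of_infty
  have hT' : ContDiff ℝ 2 fun y : E => truncatedFundamental 1 (ρ⁻¹ • y) :=
    hT.comp (contDiff_const_smul ρ⁻¹)
  rw [e, InnerProductSpace.laplacian_smul _ hT'.contDiffAt,
    laplacian_comp_smul hT, smul_eq_mul, ← mul_assoc]
  congr 1
  rw [Real.rpow_sub hρ, Real.rpow_natCast, Real.rpow_ofNat]
  field_simp

variable [MeasurableSpace E] [BorelSpace E]

lemma integrable_laplacian_truncatedFundamental {ρ : ℝ} (hρ : 0 < ρ) :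
    Integrable (Δ (truncatedFundamental ρ : E → ℝ)) :=
  (continuous_laplacian (contDiff_truncatedFundamental hρ).two_of_infty
    ).integrable_of_hasCompactSupport (hasCompactSupport_laplacian_truncatedFundamental hρ)

lemma integral_abs_laplacian_truncatedFundamental {ρ : ℝ} (hρ : 0 < ρ) :
    ∫ x : E, |(Δ (truncatedFundamental ρ : E → ℝ)) x| = ∫ x : E, |(Δ (truncatedFundamental 1 : E → ℝ)) x| := by
  have h := Measure.integral_comp_inv_smul (volume : Measure E)
    (fun x => |(Δ (truncatedFundamental 1 : E → ℝ)) x|) ρ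
  simp only [laplacian_truncatedFundamental hρ, abs_mul, integral_const_mul, h, smul_eq_mul]
  rw [abs_of_pos (by positivity), abs_of_pos (by positivity), ← mul_assoc,
    inv_mul_cancel₀ (by positivity), one_mul]

lemma abs_integral_mul_laplacian_truncatedFundamental_le {v : E → ℝ} {M : ℝ}
    (hv : ∀ᵐ x, |v x| ≤ M) {ρ : ℝ} (hρ : 0 < ρ) :
    |∫ x, v x * (Δ (truncatedFundamental ρ : E → ℝ)) x| ≤
      M * ∫ x : E, |(Δ (truncatedFundamental 1 : E → ℝ)) x| := by
  rw [← integral_abs_laplacian_truncatedFundamental hρ, ← integral_const_mul,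
    ← Real.norm_eq_abs]
  refine norm_integral_le_of_norm_le
    ((integrable_laplacian_truncatedFundamental hρ).abs.const_mul M) ?_
  filter_upwards [hv] with x hx
  rw [norm_mul, Real.norm_eq_abs, Real.norm_eq_abs]
  gcongr

/-- If `v` is bounded and `-Δ v = f` away from the origin with `f` nonnegative near infinity,
then `f` is integrable near infinity against the fundamental solution. -/
lemma lintegral_mul_rpow_lt_top {v f : E → ℝ} {M R : ℝ} (hv : ∀ᵐ x, |v x| ≤ M)
    (hvi : LocallyIntegrable v) (hf : LocallyIntegrable f) (hR : 0 < R)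
    (hfnn : ∀ᵐ x, R < ‖x‖ → 0 ≤ f x)
    (heq : ∀ φ : E → ℝ, ContDiff ℝ ∞ φ → HasCompactSupport φ → 0 ∉ tsupport φ →
      -∫ x, v x * (Δ φ) x = ∫ x, f x * φ x) :
    ∫⁻ x in {x | 2 * R ≤ ‖x‖}, ENNReal.ofReal
      (f x * (‖x‖ ^ 2) ^ ((2 - Module.finrank ℝ E : ℝ) / 2)) < ⊤ := by
  set C := M * ∫ x : E, |(Δ (truncatedFundamental 1 : E → ℝ)) x| with hC
  set F : E → ℝ≥0∞ := fun x => ENNReal.ofReal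
      (f x * (‖x‖ ^ 2) ^ ((2 - Module.finrank ℝ E : ℝ) / 2)) with hF
  have hbound : ∀ ρ, R ≤ ρ →
      ∫⁻ x in {x | 2 * R ≤ ‖x‖ ∧ ‖x‖ ≤ ρ}, F x ≤ ENNReal.ofReal (2 * C) := by
    intro ρ hρ
    have hρ0 : 0 < ρ := hR.trans_le hρ
    -- The difference is nonnegative, vanishes near the origin and beyond `2 * ρ`, and equals `‖x‖ ^
    -- (2 - n)` for `2 * R ≤ ‖x‖ ≤ ρ`. Each term contributes at most `C` to the tested equation,
    -- whatever `ρ` is.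
    set φ : E → ℝ := truncatedFundamental R - truncatedFundamental ρ with hφ
    have hsmR : ContDiff ℝ ∞ (truncatedFundamental R : E → ℝ) := contDiff_truncatedFundamental hR
    have hsmρ : ContDiff ℝ ∞ (truncatedFundamental ρ : E → ℝ) := contDiff_truncatedFundamental hρ0
    have hφs : ContDiff ℝ ∞ φ := hsmR.sub hsmρ
    have hφc : HasCompactSupport φ := by
      refine HasCompactSupport.of_support_subset_isCompact (isCompact_closedBall 0 (2 * ρ)) ?_
      intro x hx
      by_contra h
      have h' : 2 * ρ < ‖x‖ := by simpa using h
      refine hx ?_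
      simp only [hφ, Pi.sub_apply]
      rw [truncatedFundamental_eq_rpow hρ0 h'.le, truncatedFundamental_eq_rpow hR (by linarith),
        sub_self]
    have hφ0 : ∀ x, ‖x‖ ≤ R → φ x = 0 := fun x hx => by
      simp only [hφ, Pi.sub_apply]
      rw [truncatedFundamental_eq_zero hR hx, truncatedFundamental_eq_zero hρ0 (hx.trans hρ),
        sub_self]
    have hφnn : ∀ x, 0 ≤ φ x := fun x => sub_nonneg.mpr (truncatedFundamental_anti hR hρ x)
    have h0 : (0 : E) ∉ tsupport φ := by
      rw [notMem_tsupport_iff_eventuallyEq]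
      filter_upwards [ball_mem_nhds (0 : E) hR] with x hx
      exact hφ0 x (by simpa using (mem_ball.mp hx).le)
    have hfφ : Integrable fun x => f x * φ x :=
      integrable_mul_of_hasCompactSupport hf hφs.continuous hφc
    have hfφnn : 0 ≤ᵐ[volume] fun x => f x * φ x := by
      filter_upwards [hfnn] with x hx
      rcases le_or_gt ‖x‖ R with h | h
      · simp [hφ0 x h]
      · exact mul_nonneg (hx h) (hφnn x)
    have hint : ∫ x, f x * φ x ≤ 2 * C := by
      rw [← heq φ hφs hφc h0]
      have e : ∀ x, v x * (Δ φ) x = v x * (Δ (truncatedFundamental R : E → ℝ)) x -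
          v x * (Δ (truncatedFundamental ρ : E → ℝ)) x := fun x => by
        rw [hφ, ContDiffAt.laplacian_sub hsmR.two_of_infty.contDiffAt
          hsmρ.two_of_infty.contDiffAt, mul_sub]
      have hi : ∀ ρ : ℝ, 0 < ρ → Integrable fun x => v x * (Δ (truncatedFundamental ρ : E → ℝ)) x :=
        fun ρ hρ => integrable_mul_of_hasCompactSupport hvi
          (continuous_laplacian (contDiff_truncatedFundamental hρ).two_of_infty)
          (hasCompactSupport_laplacian_truncatedFundamental hρ)
      simp only [e]
      rw [integral_sub (hi R hR) (hi ρ hρ0)]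
      have h1 := abs_le.mp (abs_integral_mul_laplacian_truncatedFundamental_le hv hR)
      have h2 := abs_le.mp (abs_integral_mul_laplacian_truncatedFundamental_le hv hρ0)
      linarith [h1.1, h2.2]
    calc ∫⁻ x in {x | 2 * R ≤ ‖x‖ ∧ ‖x‖ ≤ ρ}, F x
        ≤ ∫⁻ x in {x | 2 * R ≤ ‖x‖ ∧ ‖x‖ ≤ ρ}, ENNReal.ofReal (f x * φ x) := by
          refine setLIntegral_mono_ae' ?_ (Eventually.of_forall ?_)
          · exact (measurableSet_le measurable_const measurable_norm).inter
              (measurableSet_le measurable_norm measurable_const)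
          · rintro x ⟨hx1, hx2⟩
            simp only [hF, hφ, Pi.sub_apply]
            rw [truncatedFundamental_eq_zero hρ0 hx2, truncatedFundamental_eq_rpow hR hx1,
              sub_zero]
      _ ≤ ∫⁻ x, ENNReal.ofReal (f x * φ x) := setLIntegral_le_lintegral _ _
      _ = ENNReal.ofReal (∫ x, f x * φ x) :=
          (ofReal_integral_eq_lintegral_ofReal hfφ hfφnn).symm
      _ ≤ ENNReal.ofReal (2 * C) := ENNReal.ofReal_le_ofReal hint
  have hunion : {x : E | 2 * R ≤ ‖x‖} = ⋃ k : ℕ, {x : E | 2 * R ≤ ‖x‖ ∧ ‖x‖ ≤ R + k} := by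
    ext x
    simp only [mem_ofPred_eq, mem_iUnion]
    refine ⟨fun h => ?_, fun ⟨k, h⟩ => h.1⟩
    obtain ⟨k, hk⟩ := exists_nat_ge ‖x‖
    exact ⟨k, h, by linarith⟩
  rw [hunion, setLIntegral_iUnion_of_directed]
  · refine lt_of_le_of_lt (iSup_le fun k => hbound (R + k) ?_) ENNReal.ofReal_lt_top
    have : (0 : ℝ) ≤ k := k.cast_nonneg
    linarith
  · refine Monotone.directed_le fun k l hkl x hx => ⟨hx.1, hx.2.trans ?_⟩
    have : (k : ℝ) ≤ l := by exact_mod_cast hkl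
    linarith

end TruncatedFundamentalSolution

/-! ### Divergence of integrals of homogeneous functions. -/

section Divergence

variable {E : Type*} [NormedAddCommGroup E] [NormedSpace ℝ E] [FiniteDimensional ℝ E]
  [MeasurableSpace E] [BorelSpace E] (μ : Measure E) [μ.IsAddHaarMeasure]

/-- A positive function on an open cone, homogeneous of a degree at least minus the dimension, is
not integrable near infinity. -/
lemma lintegral_eq_top_of_homogeneous {H : Set E} (hHo : IsOpen H) (hHne : (H \ {0}).Nonempty)
    (hcone : ∀ t : ℝ, 0 < t → ∀ x ∈ H, t • x ∈ H) {g : E → ℝ} {γ R : ℝ} (hR : 0 < R)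
    (hγ : -(Module.finrank ℝ E : ℝ) ≤ γ) (hg : ∀ x ∈ H, x ≠ 0 → 0 < g x)
    (hhom : ∀ x ∈ H, x ≠ 0 → g ((2 : ℝ) • x) = 2 ^ γ * g x)
    (hgm : AEMeasurable g (μ.restrict {x | R ≤ ‖x‖ ∧ ‖x‖ ≤ 2 * R})) :
    ∫⁻ x in H ∩ {x | R ≤ ‖x‖}, ENNReal.ofReal (g x) ∂μ = ⊤ := by
  by_contra hfin
  have hmS : ∀ r : ℝ, MeasurableSet (H ∩ {x : E | r ≤ ‖x‖}) := fun r =>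
    hHo.measurableSet.inter (measurableSet_le measurable_const measurable_norm)
  set S := fun r : ℝ => H ∩ {x : E | r ≤ ‖x‖} with hS
  set J := ∫⁻ x in S R, ENNReal.ofReal (g x) ∂μ with hJ
  -- The substitution `x ↦ 2x` multiplies the integral by `2 ^ (n + γ) ≥ 1`. If `J` were finite, the
  -- annulus between the two sets would carry no mass, against the positivity of `g`.
  have hscale : J ≤ ∫⁻ x in S (2 * R), ENNReal.ofReal (g x) ∂μ := by
    have hemb : MeasurableEmbedding fun x : E => (2 : ℝ) • x :=
      (Homeomorph.smulOfNeZero (2 : ℝ) two_ne_zero).measurableEmbedding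
    have hmap := Measure.map_addHaar_smul μ (two_ne_zero (α := ℝ))
    have hpre : (fun x : E => (2 : ℝ) • x) ⁻¹' S (2 * R) = S R := by
      ext x
      simp only [hS, mem_preimage, mem_inter_iff, mem_ofPred_eq, norm_smul, Real.norm_ofNat]
      refine and_congr ⟨fun h => ?_, hcone 2 two_pos x⟩ ⟨fun h => by linarith, fun h => by linarith⟩
      have := hcone 2⁻¹ (by norm_num) _ h
      rwa [smul_smul, inv_mul_cancel₀ two_ne_zero, one_smul] at this
    have h1 : ∫⁻ x in S (2 * R), ENNReal.ofReal (g x) ∂(μ.map fun x => (2 : ℝ) • x) =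
        ∫⁻ x in S R, ENNReal.ofReal (g ((2 : ℝ) • x)) ∂μ := by
      rw [hemb.restrict_map, hemb.lintegral_map, hpre]
    have h2 : ∫⁻ x in S R, ENNReal.ofReal (g ((2 : ℝ) • x)) ∂μ =
        ENNReal.ofReal (2 ^ γ) * J := by
      rw [hJ, ← lintegral_const_mul' _ _ ENNReal.ofReal_ne_top]
      refine setLIntegral_congr_fun (hmS R) fun x hx => ?_
      have hx0 : x ≠ 0 := norm_pos_iff.mp (hR.trans_le hx.2)
      rw [hhom x hx.1 hx0, ENNReal.ofReal_mul (by positivity)]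
    rw [hmap, Measure.restrict_smul, lintegral_smul_measure, h2, smul_eq_mul,
      abs_of_pos (by positivity)] at h1
    set n := Module.finrank ℝ E
    have h3 : ∫⁻ x in S (2 * R), ENNReal.ofReal (g x) ∂μ =
        ENNReal.ofReal (2 ^ n * 2 ^ γ) * J := by
      rw [ENNReal.ofReal_mul (by positivity), mul_assoc, ← h1, ← mul_assoc,
        ← ENNReal.ofReal_mul (by positivity), mul_inv_cancel₀ (by positivity), ENNReal.ofReal_one,
        one_mul]
    rw [h3]
    refine le_mul_of_one_le_left zero_le (ENNReal.one_le_ofReal.mpr ?_)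
    rw [← Real.rpow_natCast, ← Real.rpow_add two_pos]
    exact Real.one_le_rpow one_le_two (by linarith)
  have hsub : S (2 * R) ⊆ S R := fun x hx => ⟨hx.1, by
    have : 2 * R ≤ ‖x‖ := hx.2
    show R ≤ ‖x‖
    linarith⟩
  have hsplit : J = (∫⁻ x in S (2 * R), ENNReal.ofReal (g x) ∂μ) +
      ∫⁻ x in S R \ S (2 * R), ENNReal.ofReal (g x) ∂μ := by
    rw [hJ, ← lintegral_inter_add_sdiff _ (S R) (hmS (2 * R)), inter_eq_right.mpr hsub]
  have hzero : ∫⁻ x in S R \ S (2 * R), ENNReal.ofReal (g x) ∂μ = 0 := by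
    have hle : J + ∫⁻ x in S R \ S (2 * R), ENNReal.ofReal (g x) ∂μ ≤ J + 0 := by
      rw [add_zero]
      nth_rewrite 2 [hsplit]
      gcongr
    exact le_antisymm ((ENNReal.add_le_add_iff_left hfin).mp hle) zero_le
  have hAsub : S R \ S (2 * R) ⊆ {x | R ≤ ‖x‖ ∧ ‖x‖ ≤ 2 * R} := by
    rintro x ⟨⟨hxH, hx1⟩, hx2⟩
    refine ⟨hx1, ?_⟩
    by_contra h
    exact hx2 ⟨hxH, (not_le.mp h).le⟩
  rw [lintegral_eq_zero_iff' (hgm.mono_measure (Measure.restrict_mono hAsub le_rfl)).ennreal_ofReal,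
    Filter.EventuallyEq, ae_restrict_iff' ((hmS R).diff (hmS (2 * R)))] at hzero
  obtain ⟨z, hzH, hz0⟩ := hHne
  have hz : 0 < ‖z‖ := norm_pos_iff.mpr hz0
  set U : Set E := H ∩ {x | R < ‖x‖} ∩ {x | ‖x‖ < 2 * R} with hU
  have hUo : IsOpen U := (hHo.inter (isOpen_lt continuous_const continuous_norm)).inter
    (isOpen_lt continuous_norm continuous_const)
  have hUne : U.Nonempty := by
    -- Rescaling a point of the cone to norm `3R/2` puts it in the open annulus.
    refine ⟨(3 / 2 * R / ‖z‖) • z, ⟨hcone _ (by positivity) z hzH, ?_⟩, ?_⟩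
    all_goals
      simp only [mem_ofPred_eq, norm_smul, norm_div, norm_mul, norm_norm, Real.norm_of_nonneg hR.le]
      rw [div_mul_cancel₀ _ hz.ne']
      norm_num
      linarith
  refine (hUo.measure_pos μ hUne).ne' (measure_mono_null ?_ hzero)
  rintro x ⟨⟨hxH, hx1⟩, hx2⟩ h
  have h0 := h ⟨⟨hxH, (show R < ‖x‖ from hx1).le⟩, fun h' =>
    not_le_of_gt (show ‖x‖ < 2 * R from hx2) (show 2 * R ≤ ‖x‖ from h'.2)⟩
  have hpos := hg x hxH (norm_pos_iff.mp (hR.trans hx1))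
  rw [Pi.zero_apply, ENNReal.ofReal_eq_zero] at h0
  linarith

end Divergence

/-! ### Localization to a cone and vanishing near infinity. -/

section ExteriorVanishing

variable {E : Type*} [NormedAddCommGroup E] {H : Set E}

/-- The indicator of `H` can jump only at the origin, where `φ` vanishes identically nearby. Hence
cutting a test function off to `H` keeps it smooth and commutes with the Laplacian. -/
lemma eventuallyEq_indicator_of_clopen (hHo : IsOpen H) (hHc : IsClosed (H ∪ {0})) {φ : E → ℝ}
    (h0 : 0 ∉ tsupport φ) (x : E) :
    (H.indicator φ =ᶠ[𝓝 x] φ ∧ (x ∈ H ∨ φ =ᶠ[𝓝 x] 0)) ∨ (x ∉ H ∧ H.indicator φ =ᶠ[𝓝 x] 0) := by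
  by_cases hx : x ∈ H
  · left
    refine ⟨?_, Or.inl hx⟩
    filter_upwards [hHo.mem_nhds hx] with y hy using indicator_of_mem hy φ
  by_cases hx' : x ∈ H ∪ {0}
  · left
    rcases hx' with hx' | hx'
    · exact absurd hx' hx
    · rw [mem_singleton_iff.mp hx']
      have h := notMem_tsupport_iff_eventuallyEq.mp h0
      refine ⟨?_, Or.inr h⟩
      filter_upwards [h] with y hy
      by_cases hyH : y ∈ H <;> simp [hyH, hy]
  · right
    refine ⟨hx, ?_⟩
    filter_upwards [hHc.isOpen_compl.mem_nhds hx'] with y hy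
    exact indicator_of_notMem (fun h => hy (Or.inl h)) φ

variable [InnerProductSpace ℝ E]

lemma contDiff_indicator_of_clopen (hHo : IsOpen H) (hHc : IsClosed (H ∪ {0})) {φ : E → ℝ}
    (hφ : ContDiff ℝ ∞ φ) (h0 : 0 ∉ tsupport φ) : ContDiff ℝ ∞ (H.indicator φ) := by
  rw [contDiff_iff_contDiffAt]
  intro x
  rcases eventuallyEq_indicator_of_clopen hHo hHc h0 x with h | h
  · exact hφ.contDiffAt.congr_of_eventuallyEq h.1
  · exact (contDiffAt_const (c := (0 : ℝ))).congr_of_eventuallyEq h.2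

variable [FiniteDimensional ℝ E]

lemma laplacian_indicator_of_clopen (hHo : IsOpen H) (hHc : IsClosed (H ∪ {0})) {φ : E → ℝ}
    (h0 : 0 ∉ tsupport φ) (x : E) : (Δ (H.indicator φ)) x = H.indicator (Δ φ) x := by
  rcases eventuallyEq_indicator_of_clopen hHo hHc h0 x with ⟨h, hx⟩ | ⟨hx, h⟩
  · rw [(InnerProductSpace.laplacian_congr_nhds h).eq_of_nhds]
    rcases hx with hx | hx
    · rw [indicator_of_mem hx]
    · have := laplacian_eq_zero_of_eventuallyEq_zero hx
      by_cases hxH : x ∈ H <;> simp [hxH, this]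
  · rw [laplacian_eq_zero_of_eventuallyEq_zero h, indicator_of_notMem hx]

variable [MeasurableSpace E] [BorelSpace E]

/-- A weak solution localizes to an open cone that is closed away from the origin. -/
lemma integral_indicator_mul_laplacian (hHo : IsOpen H) (hHc : IsClosed (H ∪ {0})) {u f : E → ℝ}
    (heq : ∀ φ : E → ℝ, ContDiff ℝ ∞ φ → HasCompactSupport φ →
      -∫ x, u x * (Δ φ) x = ∫ x, f x * φ x)
    {φ : E → ℝ} (hφ : ContDiff ℝ ∞ φ) (hφc : HasCompactSupport φ) (h0 : 0 ∉ tsupport φ) :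
    -∫ x, H.indicator u x * (Δ φ) x = ∫ x, H.indicator f x * φ x := by
  have h := heq (H.indicator φ) (contDiff_indicator_of_clopen hHo hHc hφ h0)
    (hφc.mono (by rw [support_indicator]; exact inter_subset_right))
  simp only [laplacian_indicator_of_clopen hHo hHc h0] at h
  have e : ∀ (a b : E → ℝ) (x : E), a x * H.indicator b x = H.indicator a x * b x := by
    intro a b x
    by_cases hx : x ∈ H <;> simp [hx]
  simpa only [e] using h

lemma locallyIntegrable_indicator {f : E → ℝ} (hf : LocallyIntegrable f) (hH : MeasurableSet H) :
    LocallyIntegrable (H.indicator f) := fun x => by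
  obtain ⟨s, hs, hfs⟩ := hf x
  exact ⟨s, hs, hfs.indicator hH⟩

/-- A bounded solution that is nonnegative near infinity in a cone vanishes there, provided that
the potential decays slowly enough. -/
lemma ae_eq_zero_of_nonneg_near_infinity {V u : E → ℝ} {α m M R : ℝ} (hR : 0 < R)
    (hm : 0 ≤ m) (hmn : (Module.finrank ℝ E : ℝ) - 2 ≤ m) (hmα : m - 2 ≤ α)
    (hHo : IsOpen H) (hHc : IsClosed (H ∪ {0})) (hHne : (H \ {0}).Nonempty)
    (hcone : ∀ t : ℝ, 0 < t → ∀ x ∈ H, t • x ∈ H)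
    (hHR : IsPreconnected (H ∩ {x | R < ‖x‖}))
    (hVm : ∀ r : ℝ, 0 < r → AEMeasurable V (volume.restrict {x | r ≤ ‖x‖ ∧ ‖x‖ ≤ 2 * r}))
    (hVpos : ∀ x, x ≠ 0 → 0 < V x) (hVhom : ∀ t : ℝ, 0 < t → ∀ x, x ≠ 0 → V (t • x) = t ^ α * V x)
    (hub : ∀ᵐ x, |u x| ≤ M) (hu : LocallyIntegrable u)
    (hVu : LocallyIntegrable fun x => V x * u x)
    (heq : ∀ φ : E → ℝ, ContDiff ℝ ∞ φ → HasCompactSupport φ →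
      -∫ x, u x * (Δ φ) x = ∫ x, V x * u x * φ x)
    (hnn : ∀ᵐ x, R < ‖x‖ → 0 ≤ u x) : ∀ᵐ x, x ∈ H → R < ‖x‖ → u x = 0 := by
  set n := Module.finrank ℝ E
  set f : E → ℝ := fun x => V x * u x with hf
  set v := H.indicator u with hv
  have hvi : LocallyIntegrable v := locallyIntegrable_indicator hu hHo.measurableSet
  have hfi : LocallyIntegrable (H.indicator f) :=
    locallyIntegrable_indicator hVu hHo.measurableSet
  have hvnn : ∀ᵐ x, R < ‖x‖ → 0 ≤ v x := by
    filter_upwards [hnn] with x hx hxR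
    by_cases hxH : x ∈ H <;> simp [hv, hxH, hx hxR]
  have hfnn : ∀ᵐ x, R < ‖x‖ → 0 ≤ H.indicator f x := by
    filter_upwards [hnn] with x hx hxR
    by_cases hxH : x ∈ H
    · rw [indicator_of_mem hxH]
      exact mul_nonneg (hVpos x (norm_pos_iff.mp (hR.trans hxR))).le (hx hxR)
    · rw [indicator_of_notMem hxH]
  have heqv : ∀ φ : E → ℝ, ContDiff ℝ ∞ φ → HasCompactSupport φ → 0 ∉ tsupport φ →
      -∫ x, v x * (Δ φ) x = ∫ x, H.indicator f x * φ x := fun φ h1 h2 h3 =>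
    integral_indicator_mul_laplacian hHo hHc heq h1 h2 h3
  set A : Set E := H ∩ {x | R < ‖x‖} with hA
  have hAo : IsOpen A := hHo.inter (isOpen_lt continuous_const continuous_norm)
  have hsuper : IsWeaklySuperharmonicOn v A := by
    intro φ hφ hφc hφA hφnn
    have h0 : (0 : E) ∉ tsupport φ := fun h => by
      have : R < ‖(0 : E)‖ := (hφA h).2
      rw [norm_zero] at this
      linarith
    have h := heqv φ hφ hφc h0
    have : 0 ≤ ∫ x, H.indicator f x * φ x := by
      refine integral_nonneg_of_ae ?_
      filter_upwards [hfnn] with x hx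
      by_cases hxs : x ∈ tsupport φ
      · exact mul_nonneg (hx (hφA hxs).2) (hφnn x)
      · simp [image_eq_zero_of_notMem_tsupport hxs]
    linarith
  rcases hsuper.ae_eq_zero_or_mollify_pos hvi hAo hHR
    (by filter_upwards [hvnn] with x hx hxA using hx hxA.2) with h | h
  · filter_upwards [h] with x hx hxH hxR
    have := hx ⟨hxH, hxR⟩
    rwa [hv, indicator_of_mem hxH] at this
  exfalso
  obtain ⟨c, hc, hlow⟩ := hsuper.exists_lower_bound hR hvi hHo hHc h hm hmn
  have hvb : ∀ᵐ x, |v x| ≤ M := by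
    filter_upwards [hub] with x hx
    by_cases hxH : x ∈ H
    · simpa [hv, hxH] using hx
    · simpa [hv, hxH] using (abs_nonneg _).trans hx
  have hfin := lintegral_mul_rpow_lt_top hvb hvi hfi (by linarith : 0 < R + 2)
    (by filter_upwards [hfnn] with x hx hxR using hx (by linarith)) heqv
  set b : ℝ := (2 - n : ℝ) / 2 with hb
  -- The degree `α + (2 - n) - m` is at least `-n` exactly when `m - 2 ≤ α`.
  have htop := lintegral_eq_top_of_homogeneous (volume : Measure E) hHo hHne hcone
    (g := fun x => V x * ((‖x‖ ^ 2) ^ b * ‖x‖ ^ (-m))) (γ := α + (2 - n) - m)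
    (R := 2 * (R + 2)) (by linarith) (by linarith)
    (fun x _ hx => by
      have := norm_pos_iff.mpr hx
      have := hVpos x hx
      positivity)
    (fun x _ hx => by
      have hx' := norm_pos_iff.mpr hx
      have e : (2 : ℝ) ^ (α + (2 - n) - m) = 2 ^ α * ((2 ^ 2) ^ b * 2 ^ (-m)) := by
        rw [← Real.rpow_natCast, ← Real.rpow_mul two_pos.le, ← Real.rpow_add two_pos,
          ← Real.rpow_add two_pos]
        congr 1
        rw [hb]; push_cast; ring
      rw [e, hVhom 2 two_pos x hx, norm_smul, Real.norm_ofNat, mul_pow,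
        Real.mul_rpow (by positivity) (by positivity),
        Real.mul_rpow (by positivity) (by positivity)]
      ring)
    ((hVm _ (by linarith)).mul (by fun_prop))
  -- Inserting `c * ‖x‖ ^ (-m) ≤ u x` bounds the divergent integral by the convergent one.
  have hle : ∫⁻ x in H ∩ {x | 2 * (R + 2) ≤ ‖x‖}, ENNReal.ofReal
        (V x * ((‖x‖ ^ 2) ^ b * ‖x‖ ^ (-m))) ≤
      ENNReal.ofReal c⁻¹ * ∫⁻ x in {x | 2 * (R + 2) ≤ ‖x‖}, ENNReal.ofReal
        (H.indicator f x * (‖x‖ ^ 2) ^ b) := by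
    rw [← lintegral_const_mul' _ _ ENNReal.ofReal_ne_top]
    refine le_trans ?_ (lintegral_mono_set
      (s := H ∩ {x | 2 * (R + 2) ≤ ‖x‖}) inter_subset_right)
    refine setLIntegral_mono_ae' (hHo.measurableSet.inter
      (measurableSet_le measurable_const measurable_norm)) ?_
    filter_upwards [hlow] with x hx hxS
    obtain ⟨hxH, hxR⟩ := hxS
    have hxR' : 2 * (R + 2) ≤ ‖x‖ := hxR
    have hx1 := hx hxH (by linarith)
    rw [hv, indicator_of_mem hxH] at hx1
    rw [← ENNReal.ofReal_mul (by positivity), indicator_of_mem hxH]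
    refine ENNReal.ofReal_le_ofReal ?_
    have hV := hVpos x (norm_pos_iff.mp (by linarith))
    calc V x * ((‖x‖ ^ 2) ^ b * ‖x‖ ^ (-m))
        = c⁻¹ * (V x * (c * ‖x‖ ^ (-m)) * (‖x‖ ^ 2) ^ b) := by field_simp
      _ ≤ c⁻¹ * (V x * u x * (‖x‖ ^ 2) ^ b) := by gcongr
  rw [htop, top_le_iff] at hle
  exact (ENNReal.mul_lt_top ENNReal.ofReal_lt_top hfin).ne hle

end ExteriorVanishing

/-! ### Compactly supported solutions and their dilations. -/

section Dilation

variable {E : Type*} [NormedAddCommGroup E] [InnerProductSpace ℝ E] [FiniteDimensional ℝ E]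
  [MeasurableSpace E] [BorelSpace E]

lemma MeasureTheory.LocallyIntegrable.integrable_of_ae_eq_zero {f : E → ℝ} (hf : LocallyIntegrable f) {R : ℝ}
    (h : ∀ᵐ x, R < ‖x‖ → f x = 0) : Integrable f := by
  have h1 := (hf.integrableOn_isCompact (isCompact_closedBall (0 : E) R)).integrable_indicator
    isClosed_closedBall.measurableSet
  refine h1.congr ?_
  filter_upwards [h] with x hx
  by_cases hxR : x ∈ closedBall (0 : E) R
  · rw [indicator_of_mem hxR]
  · rw [indicator_of_notMem hxR, hx (by simpa using hxR)]

lemma ae_comp_smul {p : E → Prop} (h : ∀ᵐ x, p x) {c : ℝ} (hc : c ≠ 0) : ∀ᵐ x : E, p (c • x) :=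
  (Measure.quasiMeasurePreserving_smul volume hc).ae h

lemma aestronglyMeasurable_comp_smul {f : E → ℝ} (hf : AEStronglyMeasurable f) {c : ℝ}
    (hc : c ≠ 0) : AEStronglyMeasurable fun x : E => f (c • x) :=
  hf.comp_quasiMeasurePreserving (Measure.quasiMeasurePreserving_smul volume hc)

lemma integral_comp_smul_of_pos (f : E → ℝ) {c : ℝ} (hc : 0 < c) :
    ∫ x, f x = c ^ Module.finrank ℝ E * ∫ x, f (c • x) := by
  rw [Measure.integral_comp_smul, smul_eq_mul, abs_of_pos (by positivity), ← mul_assoc,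
    mul_inv_cancel₀ (by positivity), one_mul]

lemma abs_mollify_le {u : E → ℝ} {M : ℝ} (hub : ∀ᵐ x, |u x| ≤ M) {r : ℝ} (hr : 0 < r) (x : E) :
    |(mollifierMass E)⁻¹ * mollify u r x| ≤ M := by
  have hm := mollifierMass_pos (E := E)
  have hint : Integrable fun y : E => mollifierKernel r (x - y) :=
    (integrable_mollifierKernel hr).comp_sub_left x
  have h : |mollify u r x| ≤ M * mollifierMass E := by
    rw [← integral_mollifierKernel hr, ← integral_sub_left_eq_self (mollifierKernel r) volume x,
      ← integral_const_mul, ← Real.norm_eq_abs]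
    refine norm_integral_le_of_norm_le (hint.const_mul M) ?_
    filter_upwards [hub] with y hy
    rw [norm_mul, Real.norm_eq_abs, Real.norm_of_nonneg (mollifierKernel_nonneg hr _)]
    exact mul_le_mul_of_nonneg_right hy (mollifierKernel_nonneg hr _)
  rw [abs_mul, abs_of_pos (inv_pos.mpr hm)]
  calc (mollifierMass E)⁻¹ * |mollify u r x| ≤ (mollifierMass E)⁻¹ * (M * mollifierMass E) := by
        gcongr
    _ = M := by field_simp

/-- Mollification is symmetric for the integral pairing. -/
lemma integral_mul_mollify_comm {f g : E → ℝ} (hf : Integrable f) (hg : Integrable g) {r : ℝ}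
    (hr : 0 < r) : ∫ x, g x * mollify f r x = ∫ x, f x * mollify g r x := by
  obtain ⟨B, hB⟩ := (contDiff_mollifierKernel r).continuous.bounded_above_of_compact_support
    (hasCompactSupport_mollifierKernel (E := E) hr)
  have hint : Integrable (fun p : E × E => g p.1 * (f p.2 * mollifierKernel r (p.1 - p.2)))
      (volume.prod volume) := by
    have h := (hg.mul_prod hf).mul_bdd (c := B)
      (g := fun p : E × E => mollifierKernel r (p.1 - p.2))
      (((contDiff_mollifierKernel r).continuous.comp
        (continuous_fst.sub continuous_snd)).aestronglyMeasurable)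
      (Eventually.of_forall fun p => hB _)
    refine h.congr (Eventually.of_forall fun p => ?_)
    simp only; ring
  simp only [mollify, ← integral_const_mul]
  rw [integral_integral_swap hint]
  refine integral_congr_ae (Eventually.of_forall fun y => integral_congr_ae
    (Eventually.of_forall fun x => ?_))
  simp only
  rw [mollifierKernel_sub_comm]
  ring

/-- Dilations of a bounded function converge weakly to the function as the factor tends to one. -/
lemma tendsto_integral_mul_comp_smul {f u : E → ℝ} {M : ℝ} (hf : Integrable f) (hu : Integrable u)
    (hub : ∀ᵐ x, |u x| ≤ M) :
    Tendsto (fun t : ℝ => ∫ x, f x * u (t • x)) (𝓝 1) (𝓝 (∫ x, f x * u x)) := by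
  have hM : 0 ≤ M := by
    obtain ⟨x, hx⟩ := hub.exists
    exact (abs_nonneg _).trans hx
  have hubt : ∀ t : ℝ, t ≠ 0 → ∀ᵐ x, |u (t • x)| ≤ M := fun t ht => ae_comp_smul hub ht
  have hmt : ∀ t : ℝ, t ≠ 0 → AEStronglyMeasurable fun x => u (t • x) :=
    fun t ht => aestronglyMeasurable_comp_smul hu.aestronglyMeasurable ht
  -- For continuous `g` a change of variables moves the dilation from `u` to `g`, where dominated
  -- convergence applies. General `f` follows by `L¹` approximation, with an error uniform in `t`
  -- because `u` is bounded.
  have hcont : ∀ g : E → ℝ, Continuous g → HasCompactSupport g →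
      Tendsto (fun t : ℝ => ∫ x, g x * u (t • x)) (𝓝 1) (𝓝 (∫ x, g x * u x)) := by
    intro g hg hgc
    obtain ⟨B, hB⟩ := hg.bounded_above_of_compact_support hgc
    have h1 : Tendsto (fun t : ℝ => ∫ x, g (t⁻¹ • x) * u x) (𝓝 1) (𝓝 (∫ x, g x * u x)) := by
      refine tendsto_integral_filter_of_dominated_convergence (fun x => B * ‖u x‖) ?_ ?_
        (hu.norm.const_mul B) ?_
      · exact Eventually.of_forall fun t =>
          (hg.comp (continuous_const_smul _)).aestronglyMeasurable.mul hu.aestronglyMeasurable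
      · refine Eventually.of_forall fun t => Eventually.of_forall fun x => ?_
        rw [norm_mul]
        gcongr
        exact hB _
      · refine Eventually.of_forall fun x => ?_
        refine Tendsto.mul_const _ ?_
        have : Tendsto (fun t : ℝ => t⁻¹ • x) (𝓝 1) (𝓝 ((1 : ℝ)⁻¹ • x)) :=
          (tendsto_inv₀ one_ne_zero).smul_const x
        rw [inv_one, one_smul] at this
        exact (hg.tendsto x).comp this
    have h2 : Tendsto (fun t : ℝ => (t ^ Module.finrank ℝ E)⁻¹ * ∫ x, g (t⁻¹ • x) * u x) (𝓝 1)
        (𝓝 (((1 : ℝ) ^ Module.finrank ℝ E)⁻¹ * ∫ x, g x * u x)) :=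
      (((continuous_pow _).tendsto 1).inv₀ (by simp)).mul h1
    rw [one_pow, inv_one, one_mul] at h2
    refine h2.congr' ?_
    filter_upwards [lt_mem_nhds one_pos] with t ht
    rw [integral_comp_smul_of_pos (fun x => g (t⁻¹ • x) * u x) ht, ← mul_assoc,
      inv_mul_cancel₀ (by positivity), one_mul]
    simp only [smul_smul, inv_mul_cancel₀ ht.ne', one_smul]
  have hdiff : ∀ g : E → ℝ, Integrable g → ∀ t : ℝ, t ≠ 0 →
      |(∫ x, f x * u (t • x)) - ∫ x, g x * u (t • x)| ≤ (∫ x, ‖f x - g x‖) * M := by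
    intro g hg t ht
    have hi : ∀ h : E → ℝ, Integrable h → Integrable fun x => h x * u (t • x) := fun h hh =>
      hh.mul_bdd (hmt t ht) (hubt t ht)
    rw [← integral_sub (hi f hf) (hi g hg), ← integral_mul_const, ← Real.norm_eq_abs]
    refine norm_integral_le_of_norm_le ((hf.sub hg).norm.mul_const M) ?_
    filter_upwards [hubt t ht] with x hx
    rw [← sub_mul, norm_mul]
    gcongr
    exact hx
  rw [Metric.tendsto_nhds]
  intro ε hε
  obtain ⟨g, hgc, hfg, hg, hgi⟩ := hf.exists_hasCompactSupport_integral_sub_le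
    (show 0 < ε / (4 * (M + 1)) by positivity)
  have hsmall : (∫ x, ‖f x - g x‖) * M ≤ ε / 4 := by
    calc (∫ x, ‖f x - g x‖) * M ≤ ε / (4 * (M + 1)) * (M + 1) := by
          gcongr
          linarith
      _ = ε / 4 := by field_simp
  filter_upwards [lt_mem_nhds one_pos, (Metric.tendsto_nhds.mp (hcont g hg hgc)) (ε / 4)
    (by positivity)] with t ht htg
  have h1 := abs_le.mp ((hdiff g hgi t ht.ne').trans hsmall)
  have h2 := abs_le.mp ((hdiff g hgi 1 one_ne_zero).trans hsmall)
  simp only [one_smul] at h2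
  rw [Real.dist_eq, abs_lt] at htg ⊢
  constructor <;> linarith [h1.1, h1.2, h2.1, h2.2, htg.1, htg.2]

/-- A bounded solution with compact support vanishes: its dilations solve the equations with
proportional potentials, hence are orthogonal to it. -/
lemma ae_eq_zero_of_ae_eq_zero_near_infinity [Nontrivial E] {V u : E → ℝ} {α M R : ℝ}
    (hα : α ≠ -2) (hVpos : ∀ x, x ≠ 0 → 0 < V x)
    (hVhom : ∀ t : ℝ, 0 < t → ∀ x, x ≠ 0 → V (t • x) = t ^ α * V x)
    (hub : ∀ᵐ x, |u x| ≤ M) (hu : LocallyIntegrable u)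
    (hVu : LocallyIntegrable fun x => V x * u x)
    (heq : ∀ φ : E → ℝ, ContDiff ℝ ∞ φ → HasCompactSupport φ →
      -∫ x, u x * (Δ φ) x = ∫ x, V x * u x * φ x)
    (hzero : ∀ᵐ x, R < ‖x‖ → u x = 0) : ∀ᵐ x, u x = 0 := by
  set n := Module.finrank ℝ E
  set f : E → ℝ := fun x => V x * u x with hf
  have hui : Integrable u := hu.integrable_of_ae_eq_zero hzero
  have hfi : Integrable f := hVu.integrable_of_ae_eq_zero (R := R) <| by
    filter_upwards [hzero] with x hx hxR
    simp only [hf, hx hxR, mul_zero]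
  have hmass := mollifierMass_pos (E := E)
  have hne0 : ∀ᵐ x : E, x ≠ 0 := by
    rw [ae_iff]
    simp
  have hwc : ∀ s : ℝ, 0 < s → HasCompactSupport (mollify u s) := by
    intro s hs
    refine HasCompactSupport.of_support_subset_isCompact (isCompact_closedBall 0 (R + s)) ?_
    intro x hx
    by_contra h
    have h' : R + s < ‖x‖ := by simpa using h
    refine hx (mollify_eq_zero hs ?_)
    filter_upwards [hzero] with y hy hyx
    refine hy ?_
    rw [mem_ball, dist_comm, dist_eq_norm] at hyx
    linarith [norm_sub_norm_le x y]
  have hlapw : ∀ s : ℝ, 0 < s → ∀ z, (Δ (mollify u s)) z = -mollify f s z := by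
    intro s hs z
    rw [laplacian_mollify hu hs, mollify, ← heq _ (contDiff_mollifierKernel_sub_left s z)
      (hasCompactSupport_mollifierKernel_sub_left hs z), neg_neg]
  -- Green's identity for `u` and its dilation: the equation is tested with the dilated
  -- mollification of `u`, and the mollifier is then moved across by symmetry.
  have hident : ∀ t : ℝ, 0 < t → ∀ s : ℝ, 0 < s →
      (t ^ 2)⁻¹ * t ^ n * ∫ x, f x * mollify (fun x => u (t • x)) s x =
        ∫ x, f x * mollify u s (t⁻¹ • x) := by
    intro t ht s hs
    have hws : ContDiff ℝ ∞ (mollify u s) := contDiff_mollify hu hs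
    rw [← heq (fun x => mollify u s (t⁻¹ • x)) (hws.comp (contDiff_const_smul _))
      ((hwc s hs).comp_smul (inv_ne_zero ht.ne'))]
    simp only [laplacian_comp_smul hws.two_of_infty, hlapw s hs]
    have hut : Integrable fun x => u (t • x) := hui.comp_smul ht.ne'
    rw [← integral_mul_mollify_comm hfi hut hs]
    have h := integral_comp_smul_of_pos (fun x => u x * mollify f s (t⁻¹ • x)) ht
    simp only [smul_smul, inv_mul_cancel₀ ht.ne', one_smul] at h
    have e : ∀ x, u x * (t⁻¹ ^ 2 * -mollify f s (t⁻¹ • x)) =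
        -(t ^ 2)⁻¹ * (u x * mollify f s (t⁻¹ • x)) := fun x => by rw [inv_pow]; ring
    simp only [e, integral_const_mul, h]
    ring
  -- This removes the mollification as `s → 0`; the integrands are dominated by `‖f‖ * M`.
  have hlim : ∀ (g : E → ℝ) (hg : LocallyIntegrable g) (hgb : ∀ᵐ x, |g x| ≤ M) (c : ℝ), c ≠ 0 →
      Tendsto (fun s => ∫ x, f x * ((mollifierMass E)⁻¹ * mollify g s (c • x))) (𝓝[>] 0)
        (𝓝 (∫ x, f x * g (c • x))) := by
    intro g hg hgb c hc
    refine tendsto_integral_filter_of_dominated_convergence (fun x => ‖f x‖ * M) ?_ ?_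
      (hfi.norm.mul_const M) ?_
    · filter_upwards [self_mem_nhdsWithin] with s hs
      refine hfi.aestronglyMeasurable.mul (Continuous.aestronglyMeasurable ?_)
      exact continuous_const.mul ((contDiff_mollify hg hs).continuous.comp
        (continuous_const_smul c))
    · filter_upwards [self_mem_nhdsWithin] with s hs
      refine Eventually.of_forall fun x => ?_
      rw [norm_mul]
      gcongr
      exact abs_mollify_le hgb hs _
    · filter_upwards [ae_comp_smul (ae_tendsto_mollify hg) hc] with x hx
      exact hx.const_mul (f x)
  have hident' : ∀ t : ℝ, 0 < t →
      (t ^ 2)⁻¹ * t ^ n * ∫ x, f x * u (t • x) = ∫ x, f x * u (t⁻¹ • x) := by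
    intro t ht
    have h1 := hlim (fun x => u (t • x)) (hui.comp_smul ht.ne').locallyIntegrable
      (ae_comp_smul hub ht.ne') 1 one_ne_zero
    have h2 := hlim u hu hub t⁻¹ (inv_ne_zero ht.ne')
    simp only [one_smul] at h1
    refine tendsto_nhds_unique ((h1.const_mul ((t ^ 2)⁻¹ * t ^ n)).congr' ?_) h2
    filter_upwards [self_mem_nhdsWithin] with s hs
    have h := hident t ht s hs
    simp only [mul_left_comm (f _), integral_const_mul]
    rw [← h]
    ring
  have hscale : ∀ t : ℝ, 0 < t →
      ∫ x, f x * u (t⁻¹ • x) = t ^ n * t ^ α * ∫ x, f x * u (t • x) := by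
    intro t ht
    rw [integral_comp_smul_of_pos (fun x => f x * u (t⁻¹ • x)) ht, mul_assoc,
      ← integral_const_mul (t ^ α)]
    congr 1
    refine integral_congr_ae ?_
    filter_upwards [hne0] with x hx
    simp only [hf, smul_smul, inv_mul_cancel₀ ht.ne', one_smul]
    rw [hVhom t ht x hx]
    ring
  have horth : ∀ t : ℝ, 1 < t → ∫ x, f x * u (t • x) = 0 := by
    intro t ht
    have ht0 : 0 < t := by linarith
    have h := (hident' t ht0).trans (hscale t ht0)
    -- Green's identity and the homogeneity of `V` evaluate the same integral with the factors `t ^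
    -- (-2)` and `t ^ α`, which differ because `α ≠ -2` and `t ≠ 1`.
    have h' : ((t ^ 2)⁻¹ - t ^ α) * (t ^ n * ∫ x, f x * u (t • x)) = 0 := by
      linear_combination h
    have hne : (t ^ 2)⁻¹ - t ^ α ≠ 0 := by
      rw [← Real.rpow_natCast, ← Real.rpow_neg ht0.le, sub_ne_zero]
      intro he
      have := (Real.rpow_right_inj ht0 ht.ne').mp he
      push_cast at this
      exact hα this.symm
    have := (mul_eq_zero.mp h').resolve_left hne
    exact (mul_eq_zero.mp this).resolve_left (by positivity)
  have hself : ∫ x, f x * u x = 0 := by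
    have h1 := (tendsto_integral_mul_comp_smul hfi hui hub).mono_left
      (nhdsWithin_le_nhds (s := Ioi 1))
    refine tendsto_nhds_unique h1 (tendsto_const_nhds.congr' ?_)
    filter_upwards [self_mem_nhdsWithin] with t ht
    exact (horth t ht).symm
  have hnn : 0 ≤ᵐ[volume] fun x => f x * u x := by
    filter_upwards [hne0] with x hx
    simp only [hf, Pi.zero_apply]
    have := (hVpos x hx).le
    rw [mul_assoc]
    exact mul_nonneg this (mul_self_nonneg _)
  rw [integral_eq_zero_iff_of_nonneg_ae hnn
    (hfi.mul_bdd hui.aestronglyMeasurable hub)] at hself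
  filter_upwards [hself, hne0] with x hx hx0
  have hV := (hVpos x hx0).ne'
  simpa [hf, hV] using hx

end Dilation

/-! ### Choice of cones and conclusion. -/

section SignChange

/-- In polar coordinates this is a continuous image of a ray times the unit sphere, which is
connected in dimension at least two. -/
lemma isPreconnected_norm_gt {E : Type*} [NormedAddCommGroup E] [NormedSpace ℝ E]
    (h : 1 < Module.rank ℝ E) {R : ℝ} (hR : 0 < R) : IsPreconnected {x : E | R < ‖x‖} := by
  have himg : {x : E | R < ‖x‖} = (fun p : ℝ × E => p.1 • p.2) '' (Ioi R ×ˢ sphere (0 : E) 1) := by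
    ext x
    simp only [mem_ofPred_eq, mem_image, Prod.exists, mem_prod, mem_Ioi, mem_sphere_zero_iff_norm]
    constructor
    · intro hx
      have hx0 : ‖x‖ ≠ 0 := (hR.trans hx).ne'
      exact ⟨‖x‖, ‖x‖⁻¹ • x, ⟨hx, by rw [norm_smul, norm_inv, norm_norm, inv_mul_cancel₀ hx0]⟩,
        by rw [smul_smul, mul_inv_cancel₀ hx0, one_smul]⟩
    · rintro ⟨t, y, ⟨ht, hy⟩, rfl⟩
      rw [norm_smul, hy, mul_one, Real.norm_of_nonneg (hR.trans ht).le]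
      exact ht
  rw [himg]
  exact (isPreconnected_Ioi.prod (isPreconnected_sphere h 0 1)).image _
    (continuous_fst.smul continuous_snd).continuousOn

variable {n : ℕ} {α : ℝ} {V u : EuclideanSpace ℝ (Fin n) → ℝ}

lemma IsWeakSolution.neg (h : IsWeakSolution V u) : IsWeakSolution V (-u) where
  locallyIntegrable := h.locallyIntegrable.neg
  locallyIntegrable_mul := by
    simp only [Pi.neg_apply, mul_neg]
    exact h.locallyIntegrable_mul.neg
  integral_eq φ hφ hφc := by
    have := h.integral_eq φ hφ hφc
    simp only [Pi.neg_apply, neg_mul, mul_neg, integral_neg]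
    rw [this]

lemma exists_ae_abs_le (hu : MemLp u ∞ volume) : ∃ M, ∀ᵐ x, |u x| ≤ M := by
  refine ⟨(eLpNormEssSup u volume).toReal, ?_⟩
  have hfin : eLpNormEssSup u volume < ⊤ := by
    rw [← eLpNorm_exponent_top]; exact hu.2
  filter_upwards [ae_le_eLpNormEssSup (f := u) (μ := volume)] with x hx
  rw [← Real.norm_eq_abs, ← toReal_enorm]
  exact ENNReal.toReal_mono hfin.ne hx

lemma MemLinftyLoc.aemeasurable_annulus (hV : MemLinftyLoc V {0}ᶜ) {r : ℝ} (hr : 0 < r) :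
    AEMeasurable V (volume.restrict {x | r ≤ ‖x‖ ∧ ‖x‖ ≤ 2 * r}) := by
  refine (hV _ ?_ ?_).aestronglyMeasurable.aemeasurable
  · have h := (isCompact_closedBall (0 : EuclideanSpace ℝ (Fin n)) (2 * r)).inter_left
      (isClosed_le continuous_const continuous_norm : IsClosed {x | r ≤ ‖x‖})
    have e : {x : EuclideanSpace ℝ (Fin n) | r ≤ ‖x‖ ∧ ‖x‖ ≤ 2 * r} =
        {x | r ≤ ‖x‖} ∩ closedBall 0 (2 * r) := by
      ext x
      simp only [mem_ofPred_eq, mem_inter_iff, mem_closedBall, dist_zero_right]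
    rw [e]
    exact h
  · rintro x ⟨hx, -⟩ hx0
    rw [mem_singleton_iff.mp hx0, norm_zero] at hx
    linarith

/-- A bounded weak solution that is nonnegative near infinity vanishes near infinity. -/
lemma IsWeakSolution.ae_eq_zero_near_infinity (hn : 1 ≤ n)
    (hα₂ : n ≤ 2 → -2 < α) (hα₃ : 3 ≤ n → (n : ℝ) - 4 ≤ α) (hV : MemLinftyLoc V {0}ᶜ)
    (hVpos : ∀ x : EuclideanSpace ℝ (Fin n), x ≠ 0 → 0 < V x)
    (hVhom : IsHomogeneousOfOrder α V) (hsol : IsWeakSolution V u) {M R : ℝ} (hR : 0 < R)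
    (hub : ∀ᵐ x, |u x| ≤ M) (hnn : ∀ᵐ x, R < ‖x‖ → 0 ≤ u x) :
    ∀ᵐ x, R < ‖x‖ → u x = 0 := by
  -- The decay exponent is `max(0, n - 2)`; this is where the two cases of the hypothesis on `α`
  -- enter.
  have hm : ∃ m : ℝ, 0 ≤ m ∧ (n : ℝ) - 2 ≤ m ∧ m - 2 ≤ α := by
    rcases le_or_gt n 2 with h | h
    · have : (n : ℝ) ≤ 2 := by exact_mod_cast h
      exact ⟨0, le_rfl, by linarith, by linarith [hα₂ h]⟩
    · have : (3 : ℝ) ≤ n := by exact_mod_cast h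
      exact ⟨n - 2, by linarith, le_rfl, by linarith [hα₃ h]⟩
  obtain ⟨m, hm0, hmn, hmα⟩ := hm
  have key : ∀ H : Set (EuclideanSpace ℝ (Fin n)), IsOpen H → IsClosed (H ∪ {0}) →
      (H \ {0}).Nonempty → (∀ t : ℝ, 0 < t → ∀ x ∈ H, t • x ∈ H) →
      IsPreconnected (H ∩ {x | R < ‖x‖}) → ∀ᵐ x, x ∈ H → R < ‖x‖ → u x = 0 :=
    fun H h1 h2 h3 h4 h5 => ae_eq_zero_of_nonneg_near_infinity hR hm0
      (by rwa [finrank_euclideanSpace_fin]) hmα h1 h2 h3 h4 h5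
      (fun r hr => hV.aemeasurable_annulus hr) hVpos hVhom hub hsol.locallyIntegrable
      hsol.locallyIntegrable_mul hsol.integral_eq hnn
  rcases hn.eq_or_lt with h1 | h2
  · subst h1
    have hnorm : ∀ x : EuclideanSpace ℝ (Fin 1), ‖x‖ = |x 0| := fun x => by
      rw [EuclideanSpace.norm_eq]
      simp [Real.sqrt_sq_eq_abs]
    have hext : ∀ x : EuclideanSpace ℝ (Fin 1), x 0 = 0 → x = 0 := fun x hx => by
      rw [← norm_eq_zero, hnorm, hx, abs_zero]
    have hcont : Continuous fun x : EuclideanSpace ℝ (Fin 1) => x 0 := by fun_prop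
    -- On the line each half-line, `σ = 1` and `σ = -1`, serves as a cone of its own.
    have hhalf : ∀ σ : ℝ, |σ| = 1 → ∀ᵐ x : EuclideanSpace ℝ (Fin 1),
        x ∈ {x : EuclideanSpace ℝ (Fin 1) | 0 < σ * x 0} → R < ‖x‖ → u x = 0 := by
      intro σ hσ
      have hσ2 : σ * σ = 1 := by rw [← abs_mul_abs_self, hσ, one_mul]
      refine key _ (isOpen_lt continuous_const (continuous_const.mul hcont)) ?_ ?_ ?_ ?_
      · have : {x : EuclideanSpace ℝ (Fin 1) | 0 < σ * x 0} ∪ {0} = {x | 0 ≤ σ * x 0} := by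
          ext x
          simp only [mem_union, mem_ofPred_eq, mem_singleton_iff]
          constructor
          · rintro (h | rfl)
            · exact h.le
            · simp
          · intro h
            rcases h.eq_or_lt with h | h
            · right
              refine hext x ?_
              calc x 0 = σ * (σ * x 0) := by rw [← mul_assoc, hσ2, one_mul]
                _ = 0 := by rw [← h, mul_zero]
            · exact Or.inl h
        rw [this]
        exact isClosed_le continuous_const (continuous_const.mul hcont)
      · refine ⟨EuclideanSpace.single 0 σ, ?_, fun h => ?_⟩
        · simp [hσ2]
        · have := congrArg norm (mem_singleton_iff.mp h)
          simp [hσ] at this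
      · intro t ht x hx
        have hx' : 0 < σ * x 0 := hx
        show 0 < σ * (t • x) 0
        rw [PiLp.smul_apply, smul_eq_mul, mul_left_comm]
        positivity
      · have : {x : EuclideanSpace ℝ (Fin 1) | 0 < σ * x 0} ∩ {x | R < ‖x‖} =
            {x | R < σ * x 0} := by
          ext x
          simp only [mem_inter_iff, mem_ofPred_eq, hnorm]
          have : |σ * x 0| = |x 0| := by rw [abs_mul, hσ, one_mul]
          rw [← this]
          constructor
          · rintro ⟨h1, h2⟩
            rwa [abs_of_pos h1] at h2
          · intro h
            exact ⟨hR.trans h, h.trans_le (le_abs_self _)⟩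
        rw [this]
        refine Convex.isPreconnected ?_
        exact (convex_Ioi R).is_linear_preimage (f := fun x : EuclideanSpace ℝ (Fin 1) => σ * x 0)
          ⟨fun x y => by simp [mul_add], fun c x => by simp [mul_left_comm]⟩
    filter_upwards [hhalf 1 (by simp), hhalf (-1) (by simp)] with x hx1 hx2 hxR
    rcases lt_trichotomy (x 0) 0 with h | h | h
    · exact hx2 (show 0 < -1 * x 0 by linarith) hxR
    · rw [hext x h, norm_zero] at hxR
      linarith
    · exact hx1 (show 0 < 1 * x 0 by linarith) hxR
  · have hrank : 1 < Module.rank ℝ (EuclideanSpace ℝ (Fin n)) := by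
      rw [← Module.finrank_eq_rank, finrank_euclideanSpace_fin]
      exact_mod_cast h2
    have hset : ({0}ᶜ : Set (EuclideanSpace ℝ (Fin n))) ∩ {x | R < ‖x‖} = {x | R < ‖x‖} := by
      refine inter_eq_right.mpr fun x hx hx0 => ?_
      have hx' : R < ‖x‖ := hx
      rw [mem_singleton_iff.mp hx0, norm_zero] at hx'
      linarith
    have hne : ∃ x : EuclideanSpace ℝ (Fin n), x ≠ 0 := by
      refine ⟨EuclideanSpace.single ⟨0, hn⟩ 1, fun h => ?_⟩
      have := congrArg norm h
      simp at this
    have h := key {0}ᶜ isOpen_compl_singleton (by rw [compl_union_self]; exact isClosed_univ)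
      (by obtain ⟨x, hx⟩ := hne; exact ⟨x, hx, hx⟩)
      (fun t ht x hx => smul_ne_zero ht.ne' hx)
      (by rw [hset]; exact isPreconnected_norm_gt hrank hR)
    filter_upwards [h] with x hx hxR
    exact hx (fun h0 => by rw [mem_singleton_iff.mp h0, norm_zero] at hxR; linarith) hxR

/-- A bounded weak solution that is nonnegative near infinity vanishes identically. -/
lemma IsWeakSolution.ae_eq_zero_of_nonneg_near_infinity (hn : 1 ≤ n)
    (hα₂ : n ≤ 2 → -2 < α) (hα₃ : 3 ≤ n → (n : ℝ) - 4 ≤ α) (hV : MemLinftyLoc V {0}ᶜ)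
    (hVpos : ∀ x : EuclideanSpace ℝ (Fin n), x ≠ 0 → 0 < V x)
    (hVhom : IsHomogeneousOfOrder α V) (hu : MemLp u ∞ volume) (hsol : IsWeakSolution V u) {R : ℝ}
    (hnn : ∀ᵐ x, R < ‖x‖ → 0 ≤ u x) : u =ᵐ[volume] 0 := by
  obtain ⟨M, hM⟩ := exists_ae_abs_le hu
  -- Only the dilation argument needs this; for `n ≤ 2` it is the reason for the strict inequality.
  have hα : α ≠ -2 := by
    rcases le_or_gt n 2 with h | h
    · exact (hα₂ h).ne'
    · have : (3 : ℝ) ≤ n := by exact_mod_cast h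
      have := hα₃ h
      intro h'
      linarith
  have hzero := hsol.ae_eq_zero_near_infinity hn hα₂ hα₃ hV hVpos hVhom
    (lt_max_of_lt_right one_pos : 0 < max R 1) hM
    (hnn.mono fun x hx hxR => hx ((le_max_left _ _).trans_lt hxR))
  have : Nonempty (Fin n) := ⟨⟨0, hn⟩⟩
  exact ae_eq_zero_of_ae_eq_zero_near_infinity hα hVpos hVhom hM hsol.locallyIntegrable
    hsol.locallyIntegrable_mul hsol.integral_eq hzero

end SignChange

theorem corollary1p5 (n : ℕ) (hn : 1 ≤ n) (α : ℝ)
    (hα₂ : n ≤ 2 → -2 < α) (hα₃ : 3 ≤ n → (n : ℝ) - 4 ≤ α)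
    (V : EuclideanSpace ℝ (Fin n) → ℝ)
    (hV : MemLinftyLoc V {0}ᶜ)
    (hVpos : ∀ x : EuclideanSpace ℝ (Fin n), x ≠ 0 → 0 < V x)
    (hVhom : IsHomogeneousOfOrder α V)
    (u : EuclideanSpace ℝ (Fin n) → ℝ)
    (hu : MemLp u ∞ volume)
    (hsol : IsWeakSolution V u)
    (hu0 : ¬ u =ᵐ[volume] 0) :
    ChangesSignNearInfinity u := by
  refine fun R => ⟨fun h => hu0 ?_, fun h => hu0 ?_⟩
  -- If `u` is not positive on a set of positive measure beyond `R`, then `-u` is a solution that is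
  -- nonnegative there.
  · have hneg := hsol.neg.ae_eq_zero_of_nonneg_near_infinity (R := R) hn hα₂ hα₃ hV hVpos hVhom
      hu.neg (h.mono fun x hx hxR => by
        rw [Pi.neg_apply, Left.nonneg_neg_iff]
        exact not_lt.mp fun hpos => hx ⟨hxR, hpos⟩)
    filter_upwards [hneg] with x hx
    simpa using hx
  · exact hsol.ae_eq_zero_of_nonneg_near_infinity (R := R) hn hα₂ hα₃ hV hVpos hVhom hu
      (h.mono fun x hx hxR => not_lt.mp fun hneg => hx ⟨hxR, hneg⟩)
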